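/- Consider a single-tier downlink cellular network whose base stations (BSs) form a homogeneous Poisson point process of intensity $\lambda>0$ in $\mathbb R^2$, enumerated as $x_0,x_1,\dots$ by increasing distance $r_k=\|x_k\|$ from a test user at the origin. The user is served by the nearest BS $x_0$, all BSs transmit with the same power $P>0$, the path-loss exponent is $\eta=4$, the noise is neglected, and the fading coefficients $h_0,h_1,\dots$ are i.i.d. circularly symmetric complex Gaussian $\mathcal{CN}(0,1)$ (Rayleigh fading), independent of the BS locations. With Gaussian interfering symbols, the aggregate interference power and the signal-to-interference ratio are $$\mathcal I=\sum_{k\ge 1}P|h_k|^2r_k^{-4},\qquad \Upsilon=\frac{P|h_0|^2r_0^{-4}}{\mathcal I},$$ where the series converges almost surely. Write $\mathcal L_{\mathcal I\mid r}(z)=\mathbb E[e^{-z\mathcal I}\mid r_0=r]$. Then the service distance $r_0$ has density $2\pi\lambda r e^{-\pi\lambda r^2}$ on $(0,\infty)$, and the following hold. 1. For every $a\ge 0$, the Laplace transform of the interference at $z=a r_0^4/P$, averaged over the service distance, is $$\int_0^\infty 2\pi\lambda r e^{-\pi\lambda r^2}\,\mathcal L_{\mathcal I\mid r}\!\Big(\frac{a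 r^4}{P}\Big)\,dr=\int_0^\infty 2\pi\lambda r\, e^{-\pi\lambda r^2(\sqrt a\arctan\sqrt a+1)}\,dr=\frac{1}{1+\sqrt a\,\arctan\sqrt a},$$ and this equals $\mathbb E\big[e^{-(a r_0^4/P)\mathcal I}\big]$. 2. For every $T\ge 0$, the outage probability is $$\mathbb P\{\Upsilon<T\}=1-\frac1{1+\sqrt T\arctan\sqrt T}.$$ 3. For all real $w_1,w_2$ and all $\beta_1,\beta_2>0$, the average symbol error probability (ASEP) is $$w_1\mathbb E\big[\operatorname{erfc}\sqrt{\beta_1\Upsilon}\big]+w_2\mathbb E\big[\operatorname{erfc}^2\sqrt{\beta_2\Upsilon}\big]=\sum_{c=1}^2 w_c\left(1-\frac{c}{\sqrt\pi}\int_0^\infty\frac{e^{-z}\operatorname{erfc}(\sqrt z\,\mathbf 1_{\{c=2\}})}{\sqrt z}\cdot\frac{dz}{1+\sqrt{z/\beta_c}\,\arctan\sqrt{z/\beta_c}}\right),$$ where $\operatorname{erfc}(x)=\frac{2}{\sqrt\pi}\int_x^\infty e^{-t^2}\,dt$. In particular, the outage probability and the ASEP do not depend on the BS intensity $\lambda$.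 -/

import Mathlib

open MeasureTheory ProbabilityTheory Set Filter
open scoped ENNReal NNReal

namespace Cellular

noncomputable section

/-- The plane in which the base stations (BSs) live; the test user sits at the origin. -/
abbrev Plane : Type := EuclideanSpace ℝ (Fin 2)

/-- Number of points of the sequence `X 0 ω, X 1 ω, …` that lie in `B` (possibly infinite). -/
def count {Ω : Type*} (X : ℕ → Ω → Plane) (B : Set Plane) (ω : Ω) : ℕ∞ :=
  {n : ℕ | X n ω ∈ B}.encard

/-- The random points `X 0, X 1, …` form a homogeneous Poisson point process (PPP) of intensity
`lam` in the plane: the number of points in a bounded Borel set is Poisson distributed with mean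
`lam` times the area, and the numbers of points in pairwise disjoint sets are independent. -/
structure IsPPP {Ω : Type*} [MeasurableSpace Ω] (μ : Measure Ω) (lam : ℝ)
    (X : ℕ → Ω → Plane) : Prop where
  measurable : ∀ n, Measurable (X n)
  count_law : ∀ B : Set Plane, MeasurableSet B → Bornology.IsBounded B →
    HasLaw (count X B)
      ((poissonMeasure (ENNReal.ofReal lam * volume B).toNNReal).map (fun k : ℕ => (k : ℕ∞))) μ
  count_indep : ∀ (m : ℕ) (B : Fin m → Set Plane), (∀ i, MeasurableSet (B i)) →
    (∀ i, Bornology.IsBounded (B i)) → (Pairwise fun i j => Disjoint (B i) (B j)) →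
    iIndepFun (fun i => count X (B i)) μ

/-- The circularly symmetric complex Gaussian law `𝒞𝒩(0, 1)`: independent centred Gaussian real
and imaginary parts of variance `1/2` each. -/
def complexGaussian : Measure ℂ :=
  ((gaussianReal 0 (1 / 2)).prod (gaussianReal 0 (1 / 2))).map
    (fun p : ℝ × ℝ => (p.1 : ℂ) + (p.2 : ℂ) * Complex.I)

/-- Single-tier downlink network with Rayleigh fading and nearest-BS association: the BSs form a
PPP of intensity `lam`, enumerated by increasing distance from the test user (so `X 0` is the
serving BS); the fading coefficients `h n` of the BSs `X n` are i.i.d. `𝒞𝒩(0, 1)` and independent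
of the BS locations. -/
structure IsDownlinkNetwork {Ω : Type*} [MeasurableSpace Ω] (μ : Measure Ω) (lam : ℝ)
    (X : ℕ → Ω → Plane) (h : ℕ → Ω → ℂ) : Prop where
  ppp : IsPPP μ lam X
  ordered : ∀ᵐ ω ∂μ, Monotone fun n => ‖X n ω‖
  fading_measurable : ∀ n, Measurable (h n)
  fading_law : ∀ n, HasLaw (h n) complexGaussian μ
  fading_indep : iIndepFun h μ
  fading_indep_ppp : IndepFun (fun ω n => X n ω) (fun ω n => h n ω) μ

/-- Service distance `r₀`. -/
def serviceDist {Ω : Type*} (X : ℕ → Ω → Plane) (ω : Ω) : ℝ := ‖X 0 ω‖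

/-- Power received from the `k`-th BS, for transmit power `P` and path-loss exponent `η`. -/
def rxPower {Ω : Type*} (P η : ℝ) (X : ℕ → Ω → Plane) (h : ℕ → Ω → ℂ) (k : ℕ) (ω : Ω) : ℝ :=
  P * ‖h k ω‖ ^ 2 * ‖X k ω‖ ^ (-η)

/-- Aggregate interference power: the sum over all BSs except the serving one. -/
def interference {Ω : Type*} (P η : ℝ) (X : ℕ → Ω → Plane) (h : ℕ → Ω → ℂ) (ω : Ω) : ℝ :=
  ∑' k : ℕ, rxPower P η X h (k + 1) ω

/-- Signal-to-interference-plus-noise ratio with noise power `N₀`. -/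
def sinr {Ω : Type*} (P η N₀ : ℝ) (X : ℕ → Ω → Plane) (h : ℕ → Ω → ℂ) (ω : Ω) : ℝ :=
  rxPower P η X h 0 ω / (interference P η X h ω + N₀)

/-- Laplace transform at `z` of the aggregate interference, conditionally on `r₀ = r`. -/
def condLT {Ω : Type*} [MeasurableSpace Ω] (μ : Measure Ω) [IsFiniteMeasure μ] (P η : ℝ)
    (X : ℕ → Ω → Plane) (h : ℕ → Ω → ℂ) (z r : ℝ) : ℝ :=
  ∫ y, Real.exp (-(z * y)) ∂(condDistrib (interference P η X h) (serviceDist X) μ r)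

/-- Complementary error function. -/
def erfc (x : ℝ) : ℝ := 2 / √Real.pi * ∫ t in Ioi x, Real.exp (-t ^ 2)

/-- Outage probability at threshold `T`. -/
def outage {Ω : Type*} [MeasurableSpace Ω] (μ : Measure Ω) (Υ : Ω → ℝ) (T : ℝ) : ℝ :=
  μ.real {ω | Υ ω < T}

/-- Average symbol error probability (ASEP) with modulation parameters `w₁, w₂, β₁, β₂`, for a
receiver with signal-to-interference-plus-noise ratio `Υ`. -/
def asep {Ω : Type*} [MeasurableSpace Ω] (μ : Measure Ω) (w₁ w₂ β₁ β₂ : ℝ) (Υ : Ω → ℝ) : ℝ :=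
  w₁ * ∫ ω, erfc √(β₁ * Υ ω) ∂μ + w₂ * ∫ ω, erfc √(β₂ * Υ ω) ^ 2 ∂μ

end

end Cellular

/-!
The areas `π λ r_k²` of the discs reaching out to the successive BSs, in units of `1 / λ`, are the
arrival times of a unit-rate Poisson process, so `λ` drops out of every ratio `r_0 / r_k`. Averaging
over the Rayleigh fading turns `exp (-(a r_0 ^ η / P) I)` into `∏ (1 - ψ (s_k / s_0))` with
`ψ u = a / (a + u ^ (η / 2))`: the probability that no arrival is retained when the arrival at
`s_k` is retained with probability `ψ (s_k / s_0)`. Conditionally on `s_0` this is the void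
probability `exp (-s_0 ∫_1^∞ ψ)` of a thinned Poisson process, and since `s_0` is exponential its
mean is `1 / (1 + ∫_1^∞ ψ)`. The conditioning is avoided by sorting the arrivals into the cells of a
geometric mesh `q ^ m`, which bounds the mean from both sides up to a factor `q ^ 2`.

The power `|h_0|²` being exponential, the coverage probability `ℙ (T ≤ Υ)` is the Laplace transform
at `a = T`, and integrating the tail of `Υ` against the derivatives of `erfc √z` and `erfc² √z`
yields the symbol error probability.
-/

namespace Cellular

/-! ### Exponential law and Rayleigh fading -/

section ExponentialLaw

lemma expMeasure_eq_withDensity (r : ℝ) :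
    expMeasure r = (volume.restrict (Ioi (0 : ℝ))).withDensity
      (fun x => ENNReal.ofReal (r * Real.exp (-(r * x)))) := by
  rw [Measure.restrict_congr_set Ioi_ae_eq_Ici, ← withDensity_indicator measurableSet_Ici]
  refine congrArg volume.withDensity (funext fun x => ?_)
  by_cases hx : 0 ≤ x <;> simp [indicator, hx, gammaPDF_eq]

instance (r : ℝ) : NullSingletonClass (expMeasure r) := by
  rw [expMeasure_eq_withDensity]
  exact ⟨fun x => withDensity_absolutelyContinuous _ _ (measure_singleton x)⟩

instance : IsProbabilityMeasure (expMeasure 1) := isProbabilityMeasure_expMeasure one_pos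

lemma integral_expMeasure {r : ℝ} (hr : 0 < r) (g : ℝ → ℝ) :
    ∫ x, g x ∂expMeasure r = ∫ x in Ioi (0 : ℝ), r * Real.exp (-(r * x)) * g x := by
  rw [expMeasure_eq_withDensity, integral_withDensity_eq_integral_toReal_smul (by fun_prop)
    (ae_of_all _ fun _ => ENNReal.ofReal_lt_top)]
  refine integral_congr_ae (ae_of_all _ fun x => ?_)
  simp only [smul_eq_mul]
  rw [ENNReal.toReal_ofReal (by positivity)]

lemma integral_exp_neg_mul_expMeasure {r c : ℝ} (hr : 0 < r) (hc : 0 ≤ c) :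
    ∫ x, Real.exp (-(c * x)) ∂expMeasure r = r / (r + c) := by
  have hcomb (x : ℝ) : r * Real.exp (-(r * x)) * Real.exp (-(c * x)) =
      r * Real.exp (-(r + c) * x) := by
    rw [mul_assoc, ← Real.exp_add]
    ring_nf
  simp_rw [integral_expMeasure hr, hcomb]
  rw [integral_const_mul, integral_exp_mul_Ioi (by linarith)]
  simp only [mul_zero, Real.exp_zero]
  rw [neg_div_neg_eq, mul_one_div]

lemma expMeasure_real_Ici {r t : ℝ} (hr : 0 < r) (ht : 0 ≤ t) :
    (expMeasure r).real (Ici t) = Real.exp (-(r * t)) := by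
  have := isProbabilityMeasure_expMeasure hr
  rw [measureReal_congr Ioi_ae_eq_Ici.symm, ← compl_Iic,
    probReal_compl_eq_one_sub measurableSet_Iic, ← cdf_eq_real, cdf_expMeasure_eq hr, if_pos ht]
  ring

lemma integral_rayleigh {b : ℝ} (hb : 0 < b) (g : ℝ → ℝ) :
    ∫ r in Ioi (0 : ℝ), 2 * b * r * Real.exp (-(b * r ^ 2)) * g (b * r ^ 2) =
      ∫ x, g x ∂expMeasure 1 := by
  have hsq := integral_comp_rpow_Ioi_of_pos
    (g := fun y => Real.exp (-(b * y)) * g (b * y)) (p := 2) two_pos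
  have hlin := integral_comp_mul_left_Ioi (fun x => Real.exp (-x) * g x) 0 hb
  rw [mul_zero] at hlin
  simp only [integral_expMeasure one_pos, one_mul]
  rw [← mul_inv_cancel_left₀ hb.ne' (∫ x in Ioi (0 : ℝ), Real.exp (-x) * g x),
    ← smul_eq_mul (b⁻¹), ← hlin, ← hsq, ← integral_const_mul]
  refine integral_congr_ae (ae_of_all _ fun r => ?_)
  norm_num
  ring

theorem map_sqrt_div_expMeasure {b : ℝ} (hb : 0 < b) :
    (expMeasure 1).map (fun x => √(x / b)) = (volume.restrict (Ioi 0)).withDensity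
      (fun r => ENNReal.ofReal (2 * b * r * Real.exp (-(b * r ^ 2)))) := by
  have hmeas : Measurable fun x : ℝ => √(x / b) := by fun_prop
  have hint : Integrable (fun r => 2 * b * r * Real.exp (-(b * r ^ 2)))
      (volume.restrict (Ioi 0)) := by
    refine not_imp_comm.1 integral_undef ?_
    simpa using (integral_rayleigh hb 1).trans_ne (by simp)
  have := isFiniteMeasure_withDensity_ofReal hint.hasFiniteIntegral
  refine Measure.ext fun A hA => (measureReal_eq_measureReal_iff).1 ?_
  rw [map_measureReal_apply hmeas hA, ← integral_indicator_one (hmeas hA), ← integral_rayleigh hb,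
    ← integral_indicator_one hA, integral_withDensity_eq_integral_toReal_smul (by fun_prop)
    (ae_of_all _ fun _ => ENNReal.ofReal_lt_top)]
  refine setIntegral_congr_fun measurableSet_Ioi fun r (hr : 0 < r) => ?_
  have hroot : b * r ^ 2 ∈ (fun x => √(x / b)) ⁻¹' A ↔ r ∈ A := by
    rw [mem_preimage, mul_div_cancel_left₀ _ hb.ne', Real.sqrt_sq hr.le]
  rw [ENNReal.toReal_ofReal (by positivity), smul_eq_mul]
  by_cases hrA : r ∈ A
  · rw [indicator_of_mem hrA, indicator_of_mem (hroot.2 hrA)]; rfl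
  · rw [indicator_of_notMem hrA, indicator_of_notMem (hroot.not.2 hrA)]

end ExponentialLaw

section RayleighFading

lemma complexGaussian_eq_map_measurableEquiv :
    complexGaussian = ((gaussianReal 0 (1 / 2)).prod (gaussianReal 0 (1 / 2))).map
      Complex.measurableEquivRealProd.symm :=
  congrArg (Measure.map · _) (funext fun p => Complex.ext (by simp) (by simp))

lemma gaussianPDFReal_half_mul_gaussianPDFReal_half (x y : ℝ) :
    gaussianPDFReal 0 (1 / 2) x * gaussianPDFReal 0 (1 / 2) y =
      Real.pi⁻¹ * Real.exp (-(x ^ 2 + y ^ 2)) := by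
  have hpdf (t : ℝ) : gaussianPDFReal 0 (1 / 2) t = (√Real.pi)⁻¹ * Real.exp (-t ^ 2) := by
    have : (√2 : ℝ) ≠ 0 := by positivity
    simp [gaussianPDFReal]
    field_simp
  rw [hpdf, hpdf, mul_mul_mul_comm, ← mul_inv, Real.mul_self_sqrt Real.pi_pos.le, ← Real.exp_add,
    neg_add]

lemma complexGaussian_eq_withDensity :
    complexGaussian = volume.withDensity
      (fun z => ENNReal.ofReal (Real.pi⁻¹ * Real.exp (-‖z‖ ^ 2))) := by
  have hhalf : (1 / 2 : ℝ≥0) ≠ 0 := by norm_num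
  have hvol := Complex.volume_preserving_equiv_real_prod.symm
  ext s hs
  rw [complexGaussian_eq_map_measurableEquiv, gaussianReal_of_var_ne_zero _ hhalf,
    prod_withDensity (by fun_prop) (by fun_prop), ← Measure.volume_eq_prod,
    MeasurableEquiv.map_apply, withDensity_apply _ hs,
    withDensity_apply _ (MeasurableEquiv.measurable _ hs),
    ← hvol.setLIntegral_comp_preimage hs (by fun_prop)]
  refine lintegral_congr fun p => ?_
  rw [gaussianPDF, gaussianPDF, ← ENNReal.ofReal_mul (gaussianPDFReal_nonneg _ _ _),
    gaussianPDFReal_half_mul_gaussianPDFReal_half, Complex.measurableEquivRealProd_symm_apply,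
    ← Complex.normSq_eq_norm_sq, Complex.normSq_mk, sq, sq]

lemma integral_norm_sq_complexGaussian (g : ℝ → ℝ) :
    ∫ z, g (‖z‖ ^ 2) ∂complexGaussian = ∫ x, g x ∂expMeasure 1 := by
  have hball : (volume : Measure ℂ).real (Metric.ball 0 1) = Real.pi := by
    simp [Measure.real, Complex.volume_ball]
  rw [complexGaussian_eq_withDensity, integral_withDensity_eq_integral_toReal_smul (by fun_prop)
    (ae_of_all _ fun _ => ENNReal.ofReal_lt_top),
    integral_fun_norm_addHaar volume
      (fun r => (ENNReal.ofReal (Real.pi⁻¹ * Real.exp (-r ^ 2))).toReal • g (r ^ 2)),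
    hball, Complex.finrank_real_complex, ← integral_rayleigh one_pos, nsmul_eq_mul, smul_eq_mul,
    ← integral_const_mul, ← integral_const_mul]
  refine integral_congr_ae (ae_of_all _ fun r => ?_)
  simp only [smul_eq_mul]
  rw [ENNReal.toReal_ofReal (by positivity)]
  simp only [Nat.cast_ofNat, Nat.reduceSub, pow_one, one_mul, mul_one]
  field_simp

end RayleighFading

section RayleighFadingLaw

lemma map_norm_sq_complexGaussian :
    complexGaussian.map (fun z => ‖z‖ ^ 2) = expMeasure 1 := by
  have hmeas : Measurable fun z : ℂ => ‖z‖ ^ 2 := by fun_prop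
  have : IsFiniteMeasure complexGaussian := by
    rw [complexGaussian]
    infer_instance
  refine Measure.ext fun s hs => (measureReal_eq_measureReal_iff).1 ?_
  rw [map_measureReal_apply hmeas hs, ← integral_indicator_one (hmeas hs),
    ← integral_indicator_one hs]
  exact integral_norm_sq_complexGaussian (s.indicator 1)

variable {Ω : Type*} [MeasurableSpace Ω] {μ : Measure Ω}

lemma hasLaw_norm_sq_of_complexGaussian {Z : Ω → ℂ} (hZ : HasLaw Z complexGaussian μ) :
    HasLaw (fun ω => ‖Z ω‖ ^ 2) (expMeasure 1) μ :=
  HasLaw.fun_comp (Y := fun z : ℂ => ‖z‖ ^ 2) ⟨by fun_prop, map_norm_sq_complexGaussian⟩ hZ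

end RayleighFadingLaw

section Independence

variable {Ω α β : Type*} [MeasurableSpace Ω] [MeasurableSpace α] [MeasurableSpace β]
  {μ : Measure Ω}

lemma integral_comp_of_indepFun [IsFiniteMeasure μ] {X : Ω → α} {Y : Ω → β}
    (hX : AEMeasurable X μ) (hY : AEMeasurable Y μ) (hXY : IndepFun X Y μ) {F : α × β → ℝ}
    (hF : Measurable F) (hint : Integrable (fun ω => F (X ω, Y ω)) μ) :
    ∫ ω, F (X ω, Y ω) ∂μ = ∫ ω, ∫ ω', F (X ω, Y ω') ∂μ ∂μ := by
  have hmap := hXY.map_prod_eq_prod_map_map hX hY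
  have hFint : Integrable F ((μ.map X).prod (μ.map Y)) := by
    rw [← hmap]
    exact (integrable_map_measure hF.aestronglyMeasurable (hX.prodMk hY)).2 hint
  calc
    ∫ ω, F (X ω, Y ω) ∂μ = ∫ p, F p ∂(μ.map X).prod (μ.map Y) := by
      rw [← hmap, integral_map (hX.prodMk hY) hF.aestronglyMeasurable]
    _ = ∫ ω, ∫ y, F (X ω, y) ∂μ.map Y ∂μ := by
      rw [integral_prod _ hFint, integral_map hX
        hF.stronglyMeasurable.integral_prod_right'.aestronglyMeasurable]
    _ = ∫ ω, ∫ ω', F (X ω, Y ω') ∂μ ∂μ := by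
      refine integral_congr_ae (ae_of_all _ fun ω => integral_map hY ?_)
      exact (hF.comp measurable_prodMk_left).aestronglyMeasurable

lemma measureReal_le_of_hasLaw_exp [IsProbabilityMeasure μ] {V W : Ω → ℝ} (hV : Measurable V)
    (hV₀ : ∀ ω, 0 ≤ V ω) (hW : Measurable W) (hWlaw : HasLaw W (expMeasure 1) μ)
    (hVW : IndepFun V W μ) :
    μ.real {ω | V ω ≤ W ω} = ∫ ω, Real.exp (-V ω) ∂μ := by
  have hle : MeasurableSet {p : ℝ × ℝ | p.1 ≤ p.2} := measurableSet_le measurable_fst measurable_snd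
  have hset : MeasurableSet {ω | V ω ≤ W ω} := measurableSet_le hV hW
  have hone : Measurable (1 : ℝ × ℝ → ℝ) := measurable_one
  have htail (ω : Ω) : ∫ ω', {p : ℝ × ℝ | p.1 ≤ p.2}.indicator (1 : ℝ × ℝ → ℝ) (V ω, W ω') ∂μ =
      Real.exp (-V ω) := by
    rw [← one_mul (V ω), ← expMeasure_real_Ici one_pos (hV₀ ω), ← hWlaw.map_eq,
      map_measureReal_apply hW measurableSet_Ici, ← integral_indicator_one (hW measurableSet_Ici),
      one_mul]
    rfl
  simp_rw [← htail]
  rw [← integral_comp_of_indepFun hV.aemeasurable hW.aemeasurable hVW (hone.indicator hle)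
    ((integrable_const (1 : ℝ)).indicator hset), ← integral_indicator_one hset]
  rfl

lemma indepFun_zero_succ {ξ : ℕ → Ω → α} (hξ : ∀ n, Measurable (ξ n)) (hindep : iIndepFun ξ μ) :
    IndepFun (fun ω k => ξ (k + 1) ω) (ξ 0) μ := by
  have hdisj : Disjoint {n | 0 < n} {0} := by simp
  refine indep_of_indep_of_le_left (indep_of_indep_of_le_right
    (indep_iSup_of_disjoint (fun n => (hξ n).comap_le) hindep hdisj) ?_) ?_
  · exact le_iSup₂_of_le 0 rfl le_rfl
  · rw [MeasurableSpace.pi, MeasurableSpace.comap_iSup]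
    refine iSup_le fun k => le_iSup₂_of_le (k + 1) k.succ_pos ?_
    rw [MeasurableSpace.comap_comp]
    rfl

end Independence

section FadingAverages

variable {Ω α : Type*} [MeasurableSpace Ω] [MeasurableSpace α] {μ : Measure Ω}
  {X : Ω → α} {h : ℕ → Ω → ℂ}

lemma integral_exp_neg_sum_mul_norm_sq (hh : ∀ n, Measurable (h n))
    (hlaw : ∀ n, HasLaw (h n) complexGaussian μ) (hindep : iIndepFun h μ) (n : ℕ) {c : ℕ → ℝ}
    (hc : ∀ k, 0 ≤ c k) :
    ∫ ω, Real.exp (-∑ k ∈ Finset.range n, c k * ‖h (k + 1) ω‖ ^ 2) ∂μ =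
      ∏ k ∈ Finset.range n, 1 / (1 + c k) := by
  have hindep' : iIndepFun (fun k : Fin n => h (k + 1)) μ :=
    hindep.precomp fun a b hab => Fin.ext (Nat.succ_injective hab)
  simp_rw [← Finset.sum_neg_distrib, Real.exp_sum, Finset.prod_range]
  rw [hindep'.integral_fun_prod_comp (f := fun (k : Fin n) z => Real.exp (-(c k * ‖z‖ ^ 2)))
    (fun k => (hh _).aemeasurable) (fun k => by fun_prop)]
  refine Finset.prod_congr rfl fun k _ => ?_
  rw [← integral_exp_neg_mul_expMeasure one_pos (hc k)]
  exact (hasLaw_norm_sq_of_complexGaussian (hlaw (k + 1))).integral_comp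
    (f := fun x => Real.exp (-(c k * x))) (by fun_prop)

lemma integral_exp_neg_sum_mul_norm_sq_of_indepFun [IsProbabilityMeasure μ]
    (hh : ∀ n, Measurable (h n)) (hlaw : ∀ n, HasLaw (h n) complexGaussian μ)
    (hindep : iIndepFun h μ) (hX : Measurable X) (hXh : IndepFun X (fun ω n => h n ω) μ) (n : ℕ)
    {c : ℕ → α → ℝ} (hcm : ∀ k, Measurable (c k)) (hc : ∀ k x, 0 ≤ c k x) :
    ∫ ω, Real.exp (-∑ k ∈ Finset.range n, c k (X ω) * ‖h (k + 1) ω‖ ^ 2) ∂μ =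
      ∫ ω, ∏ k ∈ Finset.range n, 1 / (1 + c k (X ω)) ∂μ := by
  let F (p : α × (ℕ → ℂ)) : ℝ :=
    Real.exp (-∑ k ∈ Finset.range n, c k p.1 * ‖p.2 (k + 1)‖ ^ 2)
  have hF : Measurable F := by fun_prop
  have hh' : Measurable fun ω n => h n ω := measurable_pi_lambda _ hh
  have hbound (p : α × (ℕ → ℂ)) : ‖F p‖ ≤ 1 := by
    rw [Real.norm_eq_abs, Real.abs_exp, Real.exp_le_one_iff, neg_nonpos]
    exact Finset.sum_nonneg fun k _ => mul_nonneg (hc k _) (sq_nonneg _)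
  simp_rw [← integral_exp_neg_sum_mul_norm_sq hh hlaw hindep n fun k => hc k _]
  exact integral_comp_of_indepFun hX.aemeasurable hh'.aemeasurable hXh hF
    (.of_bound (hF.comp (hX.prodMk hh')).aestronglyMeasurable 1 (ae_of_all _ fun ω => hbound _))

lemma measureReal_tsum_mul_norm_sq_le_norm_sq [IsProbabilityMeasure μ]
    (hh : ∀ n, Measurable (h n)) (hlaw : ∀ n, HasLaw (h n) complexGaussian μ)
    (hindep : iIndepFun h μ) {c : ℕ → ℝ} (hc : ∀ k, 0 ≤ c k) :
    μ.real {ω | ∑' k, c k * ‖h (k + 1) ω‖ ^ 2 ≤ ‖h 0 ω‖ ^ 2} =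
      ∫ ω, Real.exp (-∑' k, c k * ‖h (k + 1) ω‖ ^ 2) ∂μ := by
  have hV : Measurable fun g : ℕ → ℂ => ∑' k, c k * ‖g k‖ ^ 2 :=
    Measurable.tsum fun k => by fun_prop
  refine measureReal_le_of_hasLaw_exp (hV.comp (measurable_pi_lambda _ fun k => hh (k + 1)))
    (fun ω => tsum_nonneg fun k => mul_nonneg (hc k) (sq_nonneg _)) ((hh 0).norm.pow_const 2)
    (hasLaw_norm_sq_of_complexGaussian (hlaw 0)) ?_
  exact (indepFun_zero_succ hh hindep).comp hV (measurable_norm.pow_const 2)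

lemma measureReal_tsum_mul_norm_sq_le_norm_sq_of_indepFun [IsProbabilityMeasure μ]
    (hh : ∀ n, Measurable (h n)) (hlaw : ∀ n, HasLaw (h n) complexGaussian μ)
    (hindep : iIndepFun h μ) (hX : Measurable X) (hXh : IndepFun X (fun ω n => h n ω) μ)
    {c : ℕ → α → ℝ} (hcm : ∀ k, Measurable (c k)) (hc : ∀ k x, 0 ≤ c k x) :
    μ.real {ω | ∑' k, c k (X ω) * ‖h (k + 1) ω‖ ^ 2 ≤ ‖h 0 ω‖ ^ 2} =
      ∫ ω, Real.exp (-∑' k, c k (X ω) * ‖h (k + 1) ω‖ ^ 2) ∂μ := by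
  let V (p : α × (ℕ → ℂ)) : ℝ := ∑' k, c k p.1 * ‖p.2 (k + 1)‖ ^ 2
  let D : Set (α × (ℕ → ℂ)) := {p | V p ≤ ‖p.2 0‖ ^ 2}
  have hV : Measurable V := Measurable.tsum fun k => by fun_prop
  have hV₀ (p : α × (ℕ → ℂ)) : 0 ≤ V p :=
    tsum_nonneg fun k => mul_nonneg (hc k _) (sq_nonneg _)
  have hD : MeasurableSet D := measurableSet_le hV (by fun_prop)
  have hh' : Measurable fun ω n => h n ω := measurable_pi_lambda _ hh
  have hXh' := hX.prodMk hh'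
  have hfubini {F : α × (ℕ → ℂ) → ℝ} (hF : Measurable F) (hF₁ : ∀ p, ‖F p‖ ≤ 1) :=
    integral_comp_of_indepFun hX.aemeasurable hh'.aemeasurable hXh hF
      (.of_bound (hF.comp hXh').aestronglyMeasurable 1 (ae_of_all _ fun ω => hF₁ _))
  have hcond (x : α) :
      ∫ ω, D.indicator 1 (x, fun n => h n ω) ∂μ = ∫ ω, Real.exp (-V (x, fun n => h n ω)) ∂μ := by
    have hsec : Measurable fun ω => (x, fun n => h n ω) := measurable_const.prodMk hh'
    rw [← measureReal_tsum_mul_norm_sq_le_norm_sq hh hlaw hindep fun k => hc k x]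
    exact integral_indicator_one (hsec hD)
  calc
    μ.real {ω | (X ω, fun n => h n ω) ∈ D} = ∫ ω, D.indicator 1 (X ω, fun n => h n ω) ∂μ :=
      (integral_indicator_one (hXh' hD)).symm
    _ = ∫ ω, ∫ ω', D.indicator 1 (X ω, fun n => h n ω') ∂μ ∂μ :=
      hfubini (measurable_one.indicator hD) fun p => by
        by_cases hp : p ∈ D <;> simp [hp]
    _ = ∫ ω, ∫ ω', Real.exp (-V (X ω, fun n => h n ω')) ∂μ ∂μ := by simp_rw [hcond]
    _ = ∫ ω, Real.exp (-V (X ω, fun n => h n ω)) ∂μ :=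
      (hfubini (F := fun p => Real.exp (-V p)) (by fun_prop) fun p => by
        simpa using hV₀ p).symm

end FadingAverages

/-! ### Poisson arrivals -/

section PoissonArrivals

variable {Ω : Type*}

/-- Number of points of the sequence `s 0 ω, s 1 ω, …` in `[a, b)`, with value `0` when there are
infinitely many. -/
noncomputable def arrivals (s : ℕ → Ω → ℝ) (a b : ℝ) (ω : Ω) : ℕ := {n | s n ω ∈ Ico a b}.ncard

/-- The random times `s 0 ≤ s 1 ≤ …` are the arrival times of a Poisson process of unit rate on
`[0, ∞)`: the number of arrivals in `[a, b)` is Poisson distributed with mean `b - a`, and the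
numbers of arrivals in consecutive intervals are independent. -/
structure IsUnitRatePoisson [MeasurableSpace Ω] (μ : Measure Ω) (s : ℕ → Ω → ℝ) : Prop where
  measurable : ∀ n, Measurable (s n)
  nonneg : ∀ n ω, 0 ≤ s n ω
  monotone : ∀ᵐ ω ∂μ, Monotone fun n => s n ω
  tendsto_atTop : ∀ᵐ ω ∂μ, Tendsto (fun n => s n ω) atTop atTop
  hasLaw_arrivals : ∀ a b, 0 ≤ a → a ≤ b →
    HasLaw (arrivals s a b) (poissonMeasure (b - a).toNNReal) μ
  iIndepFun_arrivals : ∀ t : ℕ → ℝ, 0 ≤ t 0 → Monotone t → ∀ m : ℕ,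
    iIndepFun (fun i : Fin m => arrivals s (t i) (t (i + 1))) μ

variable [MeasurableSpace Ω] {μ : Measure Ω} {s : ℕ → Ω → ℝ}

lemma integral_pow_poissonMeasure (r : ℝ≥0) (x : ℝ) :
    ∫ n, x ^ n ∂poissonMeasure r = Real.exp (-(r * (1 - x))) := by
  have hexp := (NormedSpace.expSeries_div_hasSum_exp (r * x : ℝ)).mul_left (Real.exp (-r))
  rw [← Real.exp_eq_exp_ℝ, ← Real.exp_add] at hexp
  rw [integral_poissonMeasure, show -(r * (1 - x)) = -r + r * x by ring, ← hexp.tsum_eq]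
  refine tsum_congr fun n => ?_
  rw [mul_pow, smul_eq_mul]
  ring

namespace IsUnitRatePoisson

lemma isProbabilityMeasure (hs : IsUnitRatePoisson μ s) : IsProbabilityMeasure μ :=
  (hs.hasLaw_arrivals 0 0 le_rfl le_rfl).isProbabilityMeasure

lemma integral_pow_arrivals (hs : IsUnitRatePoisson μ s) {a b : ℝ} (ha : 0 ≤ a) (hab : a ≤ b)
    (x : ℝ) : ∫ ω, x ^ arrivals s a b ω ∂μ = Real.exp (-((b - a) * (1 - x))) := by
  have h := (hs.hasLaw_arrivals a b ha hab).integral_comp (f := fun n => x ^ n)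
    Measurable.of_discrete.aestronglyMeasurable
  rwa [integral_pow_poissonMeasure, Real.coe_toNNReal _ (sub_nonneg.2 hab)] at h

lemma measureReal_arrivals_eq (hs : IsUnitRatePoisson μ s) {a b : ℝ} (ha : 0 ≤ a) (hab : a ≤ b)
    (n : ℕ) :
    μ.real {ω | arrivals s a b ω = n} =
      Real.exp (-(b - a)) * (b - a) ^ n / n.factorial := by
  have h := (hs.hasLaw_arrivals a b ha hab).measureReal_eq (p := (· = n)) .of_discrete
  rwa [ofPred_eq_eq_singleton, poissonMeasure_real_singleton,
    Real.coe_toNNReal _ (sub_nonneg.2 hab)] at h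

lemma integral_prod_arrivals (hs : IsUnitRatePoisson μ s) {t : ℕ → ℝ} (ht₀ : 0 ≤ t 0)
    (ht : Monotone t) (m : ℕ) (f : ℕ → ℕ → ℝ) :
    ∫ ω, ∏ j ∈ Finset.range m, f j (arrivals s (t j) (t (j + 1)) ω) ∂μ =
      ∏ j ∈ Finset.range m, ∫ ω, f j (arrivals s (t j) (t (j + 1)) ω) ∂μ := by
  simp_rw [Finset.prod_range]
  exact (hs.iIndepFun_arrivals t ht₀ ht m).integral_fun_prod_comp
    (f := fun j : Fin m => fun k => f j k)
    (fun j => (hs.hasLaw_arrivals _ _ (ht₀.trans (ht zero_le)) (ht (Nat.le_succ _))).aemeasurable)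
    fun j => Measurable.of_discrete.aestronglyMeasurable

lemma ae_finite (hs : IsUnitRatePoisson μ s) (a b : ℝ) :
    ∀ᵐ ω ∂μ, {n | s n ω ∈ Ico a b}.Finite := by
  filter_upwards [hs.tendsto_atTop] with ω hω
  obtain ⟨K, hK⟩ := eventually_atTop.1 (hω.eventually_ge_atTop b)
  exact (finite_lt_nat K).subset fun n hn => not_le.1 fun hKn => (hK n hKn).not_gt hn.2

lemma ae_arrivals_zero_eq_zero_iff (hs : IsUnitRatePoisson μ s) (b : ℝ) :
    ∀ᵐ ω ∂μ, arrivals s 0 b ω = 0 ↔ b ≤ s 0 ω := by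
  filter_upwards [hs.monotone, hs.ae_finite 0 b] with ω hmono hfin
  rw [arrivals, ncard_eq_zero hfin, eq_empty_iff_forall_notMem]
  refine ⟨fun hempty => not_lt.1 fun hlt => hempty 0 ⟨hs.nonneg 0 ω, hlt⟩, fun hb n hn => ?_⟩
  exact (hb.trans (hmono (Nat.zero_le n))).not_gt hn.2

lemma hasLaw_first (hs : IsUnitRatePoisson μ s) : HasLaw (s 0) (expMeasure 1) μ where
  aemeasurable := (hs.measurable 0).aemeasurable
  map_eq := by
    have := hs.isProbabilityMeasure
    refine (Measure.ext_of_Ici _ _ fun t => (measureReal_eq_measureReal_iff).1 ?_).symm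
    have hnonneg {t : ℝ} (ht : 0 ≤ t) : (expMeasure 1).real (Ici t) = μ.real (s 0 ⁻¹' Ici t) := by
      have hvoid := hs.measureReal_arrivals_eq le_rfl ht 0
      have hae : {ω | arrivals s 0 t ω = 0} =ᵐ[μ] s 0 ⁻¹' Ici t :=
        (hs.ae_arrivals_zero_eq_zero_iff t).set_eq
      rw [measureReal_congr hae] at hvoid
      rw [expMeasure_real_Ici one_pos ht]
      simpa using hvoid.symm
    rw [map_measureReal_apply (hs.measurable 0) measurableSet_Ici]
    rcases le_total 0 t with ht | ht
    · exact hnonneg ht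
    · have huniv : s 0 ⁻¹' Ici t = s 0 ⁻¹' Ici 0 :=
        (eq_univ_of_forall fun ω => ht.trans (hs.nonneg 0 ω)).trans
          (eq_univ_of_forall fun ω => hs.nonneg 0 ω).symm
      have hmono : (expMeasure 1).real (Ici 0) ≤ (expMeasure 1).real (Ici t) :=
        measureReal_mono (Ici_subset_Ici.2 ht)
      rw [expMeasure_real_Ici one_pos le_rfl, mul_zero, neg_zero, Real.exp_zero] at hmono
      rw [huniv, ← hnonneg le_rfl, expMeasure_real_Ici one_pos le_rfl, mul_zero, neg_zero,
        Real.exp_zero]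
      exact measureReal_le_one.antisymm hmono

lemma ae_first_pos (hs : IsUnitRatePoisson μ s) : ∀ᵐ ω ∂μ, 0 < s 0 ω := by
  have hne : ∀ᵐ ω ∂μ, s 0 ω ≠ 0 := by
    rw [hs.hasLaw_first.ae_iff (p := (· ≠ 0)) (by fun_prop), ae_iff]
    simp
  filter_upwards [hne] with ω hω
  exact (hs.nonneg 0 ω).lt_of_ne' hω

end IsUnitRatePoisson

end PoissonArrivals

section PoissonNetwork

/-- The mean number of points of a planar Poisson process of intensity `lam` in the disc through
`x` centred at the origin. It turns the point process into a Poisson process of unit rate. -/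
noncomputable def normalizedArea (lam : ℝ) (x : Plane) : ℝ := Real.pi * lam * ‖x‖ ^ 2

lemma measurable_normalizedArea (lam : ℝ) : Measurable (normalizedArea lam) := by
  unfold normalizedArea
  fun_prop

lemma preimage_normalizedArea_Iio {lam : ℝ} (hlam : 0 < lam) (b : ℝ) :
    normalizedArea lam ⁻¹' Iio b = Metric.ball 0 √(b / (Real.pi * lam)) := by
  ext x
  rw [mem_preimage, mem_Iio, mem_ball_zero_iff, Real.lt_sqrt (norm_nonneg x),
    lt_div_iff₀' (mul_pos Real.pi_pos hlam), normalizedArea]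

lemma volume_preimage_normalizedArea_Iio {lam : ℝ} (hlam : 0 < lam) {b : ℝ} (hb : 0 ≤ b) :
    volume (normalizedArea lam ⁻¹' Iio b) = ENNReal.ofReal (b / lam) := by
  rw [preimage_normalizedArea_Iio hlam, EuclideanSpace.volume_ball_fin_two,
    ← ENNReal.ofReal_pow (Real.sqrt_nonneg _), ← ENNReal.ofReal_mul (sq_nonneg _),
    Real.sq_sqrt (div_nonneg hb (mul_pos Real.pi_pos hlam).le)]
  congr 1
  field_simp

lemma volume_preimage_normalizedArea_Ico {lam a b : ℝ} (hlam : 0 < lam) (ha : 0 ≤ a)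
    (hab : a ≤ b) :
    volume (normalizedArea lam ⁻¹' Ico a b) = ENNReal.ofReal ((b - a) / lam) := by
  have hvol := @volume_preimage_normalizedArea_Iio lam hlam
  rw [← Iio_sdiff_Iio, preimage_sdiff, measure_sdiff (preimage_mono (Iio_subset_Iio hab))
    (measurable_normalizedArea lam measurableSet_Iio).nullMeasurableSet (by simp [hvol ha]),
    hvol ha, hvol (ha.trans hab), ← ENNReal.ofReal_sub _ (div_nonneg ha hlam.le), sub_div]

lemma isBounded_preimage_normalizedArea_Ico {lam : ℝ} (hlam : 0 < lam) (a b : ℝ) :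
    Bornology.IsBounded (normalizedArea lam ⁻¹' Ico a b) :=
  (preimage_normalizedArea_Iio hlam b ▸ Metric.isBounded_ball).subset
    (preimage_mono Ico_subset_Iio_self)

variable {Ω : Type*} [MeasurableSpace Ω] {μ : Measure Ω} {lam : ℝ} {X : ℕ → Ω → Plane}

namespace IsPPP

lemma hasLaw_arrivals (hX : IsPPP μ lam X) (hlam : 0 < lam) {a b : ℝ} (ha : 0 ≤ a) (hab : a ≤ b) :
    HasLaw (arrivals (fun n ω => normalizedArea lam (X n ω)) a b)
      (poissonMeasure (b - a).toNNReal) μ := by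
  have hcount := hX.count_law _ (measurable_normalizedArea lam measurableSet_Ico)
    (isBounded_preimage_normalizedArea_Ico hlam a b)
  rw [volume_preimage_normalizedArea_Ico hlam ha hab, ← ENNReal.ofReal_mul hlam.le,
    mul_div_cancel₀ _ hlam.ne'] at hcount
  refine HasLaw.comp (Y := ENat.toNat) ⟨Measurable.of_discrete.aemeasurable, ?_⟩ hcount
  rw [Measure.map_map .of_discrete .of_discrete]
  exact Measure.map_id

lemma iIndepFun_arrivals (hX : IsPPP μ lam X) (hlam : 0 < lam) {t : ℕ → ℝ} (ht : Monotone t)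
    (m : ℕ) :
    iIndepFun (fun i : Fin m =>
      arrivals (fun n ω => normalizedArea lam (X n ω)) (t i) (t (i + 1))) μ :=
  (hX.count_indep m (fun i => normalizedArea lam ⁻¹' Ico (t i) (t (i + 1)))
    (fun _ => measurable_normalizedArea lam measurableSet_Ico)
    (fun _ => isBounded_preimage_normalizedArea_Ico hlam _ _)
    fun _ _ hij => (ht.pairwise_disjoint_on_Ico_succ (Fin.val_injective.ne hij)).preimage _).comp
      (fun _ => ENat.toNat) fun _ => .of_discrete

lemma ae_tendsto_normalizedArea (hX : IsPPP μ lam X) (hlam : 0 < lam)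
    (hmono : ∀ᵐ ω ∂μ, Monotone fun n => normalizedArea lam (X n ω)) :
    ∀ᵐ ω ∂μ, Tendsto (fun n => normalizedArea lam (X n ω)) atTop atTop := by
  have hfin (R : ℕ) : ∀ᵐ ω ∂μ, count X (normalizedArea lam ⁻¹' Ico 0 R) ω ≠ ⊤ := by
    rw [(hX.count_law _ (measurable_normalizedArea lam measurableSet_Ico)
      (isBounded_preimage_normalizedArea_Ico hlam 0 R)).ae_iff (p := (· ≠ ⊤)) .of_discrete,
      ae_map_iff Measurable.of_discrete.aemeasurable .of_discrete]
    exact ae_of_all _ fun n => ENat.natCast_ne_top n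
  filter_upwards [ae_all_iff.2 hfin, hmono] with ω hfin hmono
  refine tendsto_atTop_atTop_of_monotone hmono fun b => ?_
  obtain ⟨R, hR⟩ := exists_nat_gt b
  by_contra! hlt
  refine hfin R (encard_eq_top_iff.2 (infinite_univ.mono fun n _ => ⟨?_, (hlt n).trans hR⟩))
  unfold normalizedArea
  positivity

theorem isUnitRatePoisson (hX : IsPPP μ lam X) (hlam : 0 < lam)
    (hmono : ∀ᵐ ω ∂μ, Monotone fun n => ‖X n ω‖) :
    IsUnitRatePoisson μ fun n ω => normalizedArea lam (X n ω) := by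
  have hmono' : ∀ᵐ ω ∂μ, Monotone fun n => normalizedArea lam (X n ω) := by
    filter_upwards [hmono] with ω hω m n hmn
    have : ‖X m ω‖ ≤ ‖X n ω‖ := hω hmn
    simp only [normalizedArea]
    gcongr
  exact
    { measurable := fun n => (measurable_normalizedArea lam).comp (hX.measurable n)
      nonneg := fun n ω => by unfold normalizedArea; positivity
      monotone := hmono'
      tendsto_atTop := hX.ae_tendsto_normalizedArea hlam hmono'
      hasLaw_arrivals := fun _ _ => hX.hasLaw_arrivals hlam
      iIndepFun_arrivals := fun _ _ => hX.iIndepFun_arrivals hlam }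

theorem map_serviceDist (hX : IsPPP μ lam X) (hlam : 0 < lam)
    (hmono : ∀ᵐ ω ∂μ, Monotone fun n => ‖X n ω‖) :
    μ.map (serviceDist X) = (volume.restrict (Ioi (0 : ℝ))).withDensity
      (fun r => ENNReal.ofReal (2 * Real.pi * lam * r * Real.exp (-(Real.pi * lam * r ^ 2)))) := by
  have hpl : 0 < Real.pi * lam := mul_pos Real.pi_pos hlam
  have hdist : serviceDist X =
      (fun t => √(t / (Real.pi * lam))) ∘ fun ω => normalizedArea lam (X 0 ω) := by
    funext ω
    rw [Function.comp_apply, normalizedArea, mul_div_cancel_left₀ _ hpl.ne',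
      Real.sqrt_sq (norm_nonneg _), serviceDist]
  have hlaw := (hX.isUnitRatePoisson hlam hmono).hasLaw_first.map_eq
  have hmeas := (hX.isUnitRatePoisson hlam hmono).measurable 0
  rw [hdist, ← Measure.map_map (by fun_prop) hmeas, hlaw, map_sqrt_div_expMeasure hpl]
  simp_rw [mul_assoc]

end IsPPP

end PoissonNetwork

/-! ### Retention of arrivals -/

section RiemannSums

variable {f : ℝ → ℝ} {t : ℕ → ℝ} {M : ℕ}

lemma integral_eq_sum_of_antitoneOn (ht : Monotone t) (hf : AntitoneOn f (Icc (t 0) (t M))) :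
    ∫ x in t 0..t M, f x = ∑ m ∈ Finset.range M, ∫ x in t m..t (m + 1), f x := by
  refine (intervalIntegral.sum_integral_adjacent_intervals fun m hm => ?_).symm
  refine AntitoneOn.intervalIntegrable (hf.mono ?_)
  rw [uIcc_of_le (ht m.le_succ)]
  exact Icc_subset_Icc (ht m.zero_le) (ht hm)

lemma sum_sub_mul_right_le_integral (ht : Monotone t) (hf : AntitoneOn f (Icc (t 0) (t M))) :
    ∑ m ∈ Finset.range M, (t (m + 1) - t m) * f (t (m + 1)) ≤ ∫ x in t 0..t M, f x := by
  rw [integral_eq_sum_of_antitoneOn ht hf]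
  refine Finset.sum_le_sum fun m hm => ?_
  have hle := ht m.le_succ
  have hsub : Icc (t m) (t (m + 1)) ⊆ Icc (t 0) (t M) :=
    Icc_subset_Icc (ht m.zero_le) (ht (Finset.mem_range.1 hm))
  rw [← smul_eq_mul, ← intervalIntegral.integral_const]
  refine intervalIntegral.integral_mono_on hle intervalIntegrable_const
    (AntitoneOn.intervalIntegrable (by rw [uIcc_of_le hle]; exact hf.mono hsub)) fun x hx => ?_
  exact hf (hsub hx) (hsub (right_mem_Icc.2 hle)) hx.2

lemma integral_le_sum_sub_mul_left (ht : Monotone t) (hf : AntitoneOn f (Icc (t 0) (t M))) :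
    ∫ x in t 0..t M, f x ≤ ∑ m ∈ Finset.range M, (t (m + 1) - t m) * f (t m) := by
  rw [integral_eq_sum_of_antitoneOn ht hf]
  refine Finset.sum_le_sum fun m hm => ?_
  have hle := ht m.le_succ
  have hsub : Icc (t m) (t (m + 1)) ⊆ Icc (t 0) (t M) :=
    Icc_subset_Icc (ht m.zero_le) (ht (Finset.mem_range.1 hm))
  rw [← smul_eq_mul, ← intervalIntegral.integral_const]
  refine intervalIntegral.integral_mono_on hle
    (AntitoneOn.intervalIntegrable (by rw [uIcc_of_le hle]; exact hf.mono hsub))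
    intervalIntegrable_const fun x hx => ?_
  exact hf (hsub (left_mem_Icc.2 hle)) (hsub hx) hx.1

end RiemannSums

/-- A function `ψ` giving the probability with which an arrival `u` times later than the first one
is retained, when arrivals are retained independently. -/
structure IsRetentionProfile (ψ : ℝ → ℝ) : Prop where
  measurable : Measurable ψ
  antitoneOn : AntitoneOn ψ (Ici 1)
  mapsTo : MapsTo ψ (Ici 1) (Icc 0 1)
  integrableOn : IntegrableOn ψ (Ioi 1)

/-- Conditional probability, given the arrivals `x 0 ≤ x 1 ≤ …`, that none of `x 1, …, x n` is
retained. -/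
noncomputable def noneRetained (ψ : ℝ → ℝ) (x : ℕ → ℝ) (n : ℕ) : ℝ :=
  ∏ k ∈ Finset.range n, (1 - ψ (x (k + 1) / x 0))

namespace IsRetentionProfile

variable {ψ : ℝ → ℝ}

lemma integral_nonneg (hψ : IsRetentionProfile ψ) : 0 ≤ ∫ u in Ioi 1, ψ u :=
  setIntegral_nonneg measurableSet_Ioi fun _ hu => (hψ.mapsTo (Ioi_subset_Ici_self hu)).1

lemma integral_interval_le (hψ : IsRetentionProfile ψ) {b : ℝ} (hb : 1 ≤ b) :
    ∫ u in (1 : ℝ)..b, ψ u ≤ ∫ u in Ioi 1, ψ u := by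
  rw [intervalIntegral.integral_of_le hb]
  refine setIntegral_mono_set hψ.integrableOn ?_ Ioc_subset_Ioi_self.eventuallyLE
  exact (ae_restrict_iff' measurableSet_Ioi).2
    (ae_of_all _ fun _ hu => (hψ.mapsTo (Ioi_subset_Ici_self hu)).1)

lemma sub_one_le_integral_Ioi (hψ : IsRetentionProfile ψ) {b : ℝ} (hb : 1 ≤ b) :
    (∫ u in Ioi 1, ψ u) - (b - 1) ≤ ∫ u in Ioi b, ψ u := by
  have hle : ∫ u in (1 : ℝ)..b, ψ u ≤ b - 1 := by
    rw [← mul_one (b - 1), ← smul_eq_mul, ← intervalIntegral.integral_const]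
    refine intervalIntegral.integral_mono_on hb ?_ intervalIntegrable_const
      fun u hu => (hψ.mapsTo hu.1).2
    exact (intervalIntegrable_iff_integrableOn_Ioc_of_le hb).2
      (hψ.integrableOn.mono_set Ioc_subset_Ioi_self)
  have hsplit := intervalIntegral.integral_Ioi_sub_Ioi hψ.integrableOn hb
  linarith

lemma tendsto_atTop_zero (hψ : IsRetentionProfile ψ) : Tendsto ψ atTop (nhds 0) := by
  have hbound : ∀ᶠ u in atTop, ψ u ≤ (∫ v in Ioi 1, ψ v) / (u - 1) := by
    filter_upwards [eventually_gt_atTop 1] with u hu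
    rw [le_div_iff₀' (sub_pos.2 hu)]
    refine le_trans ?_ (hψ.integral_interval_le hu.le)
    rw [← smul_eq_mul, ← intervalIntegral.integral_const]
    refine intervalIntegral.integral_mono_on hu.le intervalIntegrable_const ?_
      fun v hv => hψ.antitoneOn hv.1 hu.le hv.2
    exact (intervalIntegrable_iff_integrableOn_Ioc_of_le hu.le).2
      (hψ.integrableOn.mono_set Ioc_subset_Ioi_self)
  refine squeeze_zero' ?_ hbound
    (tendsto_const_nhds.div_atTop (tendsto_atTop_add_const_right _ _ tendsto_id))
  filter_upwards [eventually_ge_atTop 1] with u hu using (hψ.mapsTo hu).1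

/-- Apart from its first term, the sum is `q ^ 2` times a lower Riemann sum on the mesh `q ^ m`. -/
lemma sum_geometric_le (hψ : IsRetentionProfile ψ) {q : ℝ} (hq : 1 ≤ q) (M : ℕ) :
    ∑ m ∈ Finset.range (M + 1), (q ^ (m + 2) - q ^ (m + 1)) * ψ (q ^ m) ≤
      q ^ 2 - q + q ^ 2 * ∫ u in Ioi 1, ψ u := by
  have hmono : Monotone fun m : ℕ => q ^ m := pow_right_mono₀ hq
  have hriemann := sum_sub_mul_right_le_integral (f := ψ) (M := M) hmono
    (hψ.antitoneOn.mono fun x hx => (pow_zero q).ge.trans hx.1)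
  rw [pow_zero] at hriemann
  have hfirst : (q ^ 2 - q) * ψ 1 ≤ q ^ 2 - q :=
    mul_le_of_le_one_right (by nlinarith) (hψ.mapsTo self_mem_Ici).2
  have hfactor : ∑ m ∈ Finset.range M, (q ^ (m + 1 + 2) - q ^ (m + 1 + 1)) * ψ (q ^ (m + 1)) =
      q ^ 2 * ∑ m ∈ Finset.range M, (q ^ (m + 1) - q ^ m) * ψ (q ^ (m + 1)) := by
    rw [Finset.mul_sum]
    exact Finset.sum_congr rfl fun m _ => by ring
  rw [Finset.sum_range_succ', hfactor, add_comm]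
  simp only [zero_add, pow_zero, pow_one]
  gcongr
  exact hriemann.trans (hψ.integral_interval_le (one_le_pow₀ hq))

lemma integral_le_sum_geometric (hψ : IsRetentionProfile ψ) {q : ℝ} (hq : 1 ≤ q) (M : ℕ) :
    ∫ u in q ^ 2..q ^ (M + 2), ψ u ≤
      q * ∑ m ∈ Finset.range M, (q ^ (m + 2) - q ^ (m + 1)) * ψ (q ^ (m + 2)) := by
  have hmono : Monotone fun m : ℕ => q ^ (m + 2) := fun m n hmn => pow_le_pow_right₀ hq (by lia)
  have hriemann := integral_le_sum_sub_mul_left (f := ψ) (M := M) hmono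
    (hψ.antitoneOn.mono fun x hx => (one_le_pow₀ hq).trans hx.1)
  rw [zero_add] at hriemann
  refine hriemann.trans_eq ?_
  rw [Finset.mul_sum]
  exact Finset.sum_congr rfl fun m _ => by ring

lemma one_sub_mem_Icc (hψ : IsRetentionProfile ψ) {u : ℝ} (hu : 1 ≤ u) : 1 - ψ u ∈ Icc 0 1 :=
  ⟨sub_nonneg.2 (hψ.mapsTo hu).2, sub_le_self 1 (hψ.mapsTo hu).1⟩

lemma one_sub_div_mem_Icc (hψ : IsRetentionProfile ψ) {x : ℕ → ℝ} (hx : Monotone x)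
    (hpos : 0 < x 0) (k : ℕ) : 1 - ψ (x (k + 1) / x 0) ∈ Icc 0 1 :=
  hψ.one_sub_mem_Icc ((one_le_div hpos).2 (hx (k + 1).zero_le))

lemma noneRetained_mem_Icc (hψ : IsRetentionProfile ψ) {x : ℕ → ℝ} (hx : Monotone x)
    (hpos : 0 < x 0) (n : ℕ) : noneRetained ψ x n ∈ Icc 0 1 :=
  have h := hψ.one_sub_div_mem_Icc hx hpos
  ⟨Finset.prod_nonneg fun k _ => (h k).1,
    Finset.prod_le_one (fun k _ => (h k).1) fun k _ => (h k).2⟩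

lemma antitone_noneRetained (hψ : IsRetentionProfile ψ) {x : ℕ → ℝ} (hx : Monotone x)
    (hpos : 0 < x 0) : Antitone (noneRetained ψ x) :=
  antitone_nat_of_succ_le fun n => by
    rw [noneRetained, Finset.prod_range_succ]
    exact mul_le_of_le_one_right (hψ.noneRetained_mem_Icc hx hpos n).1
      (hψ.one_sub_div_mem_Icc hx hpos n).2

end IsRetentionProfile

section GeometricMesh

lemma prod_pow_ncard_Ico {x t : ℕ → ℝ} (ht : Monotone t) {M K : ℕ} (hK : ∀ k, K ≤ k → t M ≤ x k)
    (y : ℕ → ℝ) :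
    ∏ m ∈ Finset.range M, y m ^ {n | x n ∈ Ico (t m) (t (m + 1))}.ncard =
      ∏ k ∈ Finset.range K, ∏ m ∈ Finset.range M,
        if x k ∈ Ico (t m) (t (m + 1)) then y m else 1 := by
  rw [Finset.prod_comm]
  refine Finset.prod_congr rfl fun m hm => ?_
  have hset : {n | x n ∈ Ico (t m) (t (m + 1))} =
      ↑{k ∈ Finset.range K | x k ∈ Ico (t m) (t (m + 1))} := by
    ext n
    simp only [Finset.coe_filter, Finset.mem_range, mem_ofPred_eq]
    refine ⟨fun hn => ⟨not_le.1 fun hKn => ?_, hn⟩, And.right⟩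
    exact (hn.2.trans_le (ht (Finset.mem_range.1 hm))).not_ge (hK n hKn)
  rw [hset, ncard_coe_finset, Finset.prod_ite, Finset.prod_const, Finset.prod_const_one, mul_one]

lemma prod_ite_mem_Ico_induction {t : ℕ → ℝ} (ht : Monotone t) {M : ℕ} {y : ℕ → ℝ} {x : ℝ}
    {p : ℝ → Prop} (hmem : ∀ m < M, x ∈ Ico (t m) (t (m + 1)) → p (y m))
    (hnot : x ∉ Ico (t 0) (t M) → p 1) :
    p (∏ m ∈ Finset.range M, if x ∈ Ico (t m) (t (m + 1)) then y m else 1) := by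
  by_cases h : ∃ m < M, x ∈ Ico (t m) (t (m + 1))
  · obtain ⟨m, hmM, hm⟩ := h
    have hne : ∀ j ∈ Finset.range M, j ≠ m →
        (if x ∈ Ico (t j) (t (j + 1)) then y j else 1) = 1 := fun j _ hjm =>
      if_neg fun hj => disjoint_left.1 (ht.pairwise_disjoint_on_Ico_succ hjm) hj hm
    rw [Finset.prod_eq_single_of_mem m (Finset.mem_range.2 hmM) hne, if_pos hm]
    exact hmem m hmM hm
  · push Not at h
    rw [Finset.prod_congr rfl fun m hm => if_neg (h m (Finset.mem_range.1 hm)),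
      Finset.prod_const_one]
    refine hnot fun hx => ?_
    obtain ⟨m, hmM, hm⟩ := mem_iUnion₂.1 (Ico_subset_biUnion_Ico M t hx)
    exact h m (Finset.mem_range.1 hmM) hm

namespace IsRetentionProfile

variable {ψ : ℝ → ℝ} {x : ℕ → ℝ} {r q : ℝ}

lemma exists_noneRetained_le_prod_pow (hψ : IsRetentionProfile ψ) (hx : Monotone x)
    (hx_top : Tendsto x atTop atTop) (hr : 0 < r) (hq : 1 ≤ q) (hx₀ : x 0 ∈ Ico r (r * q))
    (M : ℕ) :
    ∃ n, noneRetained ψ x n ≤ ∏ m ∈ Finset.range M, (1 - ψ (q ^ (m + 2))) ^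
      {n | x n ∈ Ico (r * q ^ (m + 1)) (r * q ^ (m + 2))}.ncard := by
  have hmono : Monotone fun m : ℕ => r * q ^ (m + 1) := fun m n hmn =>
    mul_le_mul_of_nonneg_left (pow_right_mono₀ hq (by lia)) hr.le
  obtain ⟨n, hn⟩ := eventually_atTop.1 (hx_top.eventually_ge_atTop (r * q ^ (M + 1)))
  refine ⟨n, ?_⟩
  rw [prod_pow_ncard_Ico (K := n + 1) hmono fun k hk => hn k (by lia), Finset.prod_range_succ',
    prod_ite_mem_Ico_induction (p := (· = 1)) hmono (fun m _ hm => ?_) fun _ => rfl, mul_one]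
  · have hpos : 0 < x 0 := hr.trans_le hx₀.1
    have hfactor := hψ.one_sub_div_mem_Icc hx hpos
    refine Finset.prod_le_prod (fun k _ => (hfactor k).1) fun k _ =>
      prod_ite_mem_Ico_induction (p := fun y => 1 - ψ (x (k + 1) / x 0) ≤ y) hmono
        (fun m _ hm => ?_) fun _ => (hfactor k).2
    refine sub_le_sub_left (hψ.antitoneOn ((one_le_div hpos).2 (hx (k + 1).zero_le))
      (one_le_pow₀ hq) ((div_le_iff₀' hpos).2 (hm.2.le.trans ?_))) 1
    exact mul_le_mul_of_nonneg_right hx₀.1 (by positivity)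
  · have hle : r * q ≤ r * q ^ (m + 1) := by simpa using hmono m.zero_le
    exact absurd (hx₀.2.trans_le hle) hm.1.not_gt

lemma one_sub_mul_prod_ite_le (hψ : IsRetentionProfile ψ) (hr : 0 < r) (hq : 1 ≤ q) {a u : ℝ}
    (ha : 0 < a) (har : a ≤ r * q) (hu : r * q ≤ u) (M : ℕ) :
    (1 - ψ (q ^ M)) * ∏ m ∈ Finset.range M,
      (if u ∈ Ico (r * q ^ (m + 1)) (r * q ^ (m + 2)) then 1 - ψ (q ^ m) else 1) ≤
        1 - ψ (u / a) := by
  have hmono : Monotone fun m : ℕ => r * q ^ (m + 1) := fun m n hmn =>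
    mul_le_mul_of_nonneg_left (pow_right_mono₀ hq (by lia)) hr.le
  have hψ01 (m : ℕ) : 1 - ψ (q ^ m) ∈ Icc 0 1 := hψ.one_sub_mem_Icc (one_le_pow₀ hq)
  have hratio {m : ℕ} (hm : r * q ^ (m + 1) ≤ u) : 1 - ψ (q ^ m) ≤ 1 - ψ (u / a) := by
    refine sub_le_sub_left (hψ.antitoneOn (one_le_pow₀ hq) ((one_le_div ha).2 (har.trans hu))
      ((le_div_iff₀' ha).2 (le_trans ?_ hm))) 1
    rw [pow_succ', ← mul_assoc]
    gcongr
  refine prod_ite_mem_Ico_induction (p := fun y => (1 - ψ (q ^ M)) * y ≤ 1 - ψ (u / a)) hmono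
    (fun m _ hm => ?_) fun hnot => ?_
  · exact (mul_le_of_le_one_left (hψ01 m).1 (hψ01 M).2).trans (hratio hm.1)
  · rw [mul_one]
    exact hratio (not_lt.1 fun hlt => hnot ⟨by simpa using hu, hlt⟩)

lemma pow_mul_prod_pow_le_noneRetained (hψ : IsRetentionProfile ψ) (hx : Monotone x)
    (hx_top : Tendsto x atTop atTop) (hr : 0 < r) (hq : 1 ≤ q) (hx₀ : x 0 ∈ Ico r (r * q))
    (hx₁ : r * q ≤ x 1) (M n : ℕ) :
    (1 - ψ (q ^ M)) ^ n * ∏ m ∈ Finset.range M, (1 - ψ (q ^ m)) ^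
      {n | x n ∈ Ico (r * q ^ (m + 1)) (r * q ^ (m + 2))}.ncard ≤ noneRetained ψ x n := by
  have hmono : Monotone fun m : ℕ => r * q ^ (m + 1) := fun m n hmn =>
    mul_le_mul_of_nonneg_left (pow_right_mono₀ hq (by lia)) hr.le
  have hψ01 (m : ℕ) : 1 - ψ (q ^ m) ∈ Icc 0 1 := hψ.one_sub_mem_Icc (one_le_pow₀ hq)
  obtain ⟨K, hK⟩ := eventually_atTop.1 (hx_top.eventually_ge_atTop (r * q ^ (M + 1)))
  set Y : ℝ → ℝ := fun u => ∏ m ∈ Finset.range M,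
    if u ∈ Ico (r * q ^ (m + 1)) (r * q ^ (m + 2)) then 1 - ψ (q ^ m) else 1
  have hY01 (u : ℝ) : Y u ∈ Icc 0 1 :=
    prod_ite_mem_Ico_induction (p := (· ∈ Icc 0 1)) hmono (fun m _ _ => hψ01 m) fun _ => by simp
  have hnonneg : 0 ≤ ∏ k ∈ Finset.range n, Y (x (k + 1)) :=
    Finset.prod_nonneg fun k _ => (hY01 _).1
  calc _ = (1 - ψ (q ^ M)) ^ n * ∏ k ∈ Finset.range (n + K + 1), Y (x k) := by
        rw [prod_pow_ncard_Ico (K := n + K + 1) hmono fun k hk => hK k (by lia)]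
    _ ≤ (1 - ψ (q ^ M)) ^ n * ∏ k ∈ Finset.range n, Y (x (k + 1)) := by
        rw [Finset.prod_range_succ', Finset.prod_range_add, mul_assoc]
        refine mul_le_mul_of_nonneg_left (mul_le_of_le_one_right hnonneg ?_)
          (pow_nonneg (hψ01 M).1 n)
        exact mul_le_one₀ (Finset.prod_le_one (fun k _ => (hY01 _).1) fun k _ => (hY01 _).2)
          (hY01 _).1 (hY01 _).2
    _ = ∏ k ∈ Finset.range n, (1 - ψ (q ^ M)) * Y (x (k + 1)) := by
        rw [Finset.prod_mul_distrib, Finset.prod_const, Finset.card_range]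
    _ ≤ noneRetained ψ x n :=
        Finset.prod_le_prod (fun k _ => mul_nonneg (hψ01 M).1 (hY01 _).1) fun k _ =>
          hψ.one_sub_mul_prod_ite_le hr hq (hr.trans_le hx₀.1) hx₀.2.le
            (hx₁.trans (hx k.succ_pos)) M

end IsRetentionProfile

end GeometricMesh

section FirstArrival

/-- The points `0, r, r * q, r * q ^ 2, …`. -/
def geomMesh (r q : ℝ) : ℕ → ℝ
  | 0 => 0
  | j + 1 => r * q ^ j

lemma monotone_geomMesh {r q : ℝ} (hr : 0 ≤ r) (hq : 1 ≤ q) : Monotone (geomMesh r q) :=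
  monotone_nat_of_le_succ fun
    | 0 => by simpa [geomMesh] using hr
    | j + 1 => mul_le_mul_of_nonneg_left (pow_right_mono₀ hq j.le_succ) hr

/-- Functions of the numbers of arrivals in the successive cells of a mesh: the indicator that the
first cell is empty, then `f`, then powers of `y 0, y 1, …`. -/
def cellWeight (f : ℕ → ℝ) (y : ℕ → ℝ) : ℕ → ℕ → ℝ
  | 0, k => if k = 0 then 1 else 0
  | 1, k => f k
  | m + 2, k => y m ^ k

variable {f y : ℕ → ℝ}

lemma cellWeight_mem_Icc (hf : ∀ k, f k ∈ Icc 0 1) (hy : ∀ m, y m ∈ Icc 0 1) :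
    ∀ j k, cellWeight f y j k ∈ Icc 0 1
  | 0, k => by rw [cellWeight]; split_ifs <;> simp
  | 1, k => hf k
  | m + 2, k => ⟨pow_nonneg (hy m).1 k, pow_le_one₀ (hy m).1 (hy m).2⟩

variable {Ω : Type*} {s : ℕ → Ω → ℝ} {r q : ℝ}

/-- The product of the weights `cellWeight f y` over the first `M + 2` cells of a geometric mesh. -/
noncomputable def meshWeight (s : ℕ → Ω → ℝ) (r q : ℝ) (f y : ℕ → ℝ) (M : ℕ) (ω : Ω) : ℝ :=
  ∏ j ∈ Finset.range (M + 2),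
    cellWeight f y j (arrivals s (geomMesh r q j) (geomMesh r q (j + 1)) ω)

lemma meshWeight_eq (s : ℕ → Ω → ℝ) (r q : ℝ) (f y : ℕ → ℝ) (M : ℕ) (ω : Ω) :
    meshWeight s r q f y M ω =
      (if arrivals s 0 r ω = 0 then f (arrivals s r (r * q) ω) else 0) *
        ∏ m ∈ Finset.range M, y m ^ arrivals s (r * q ^ (m + 1)) (r * q ^ (m + 2)) ω := by
  rw [meshWeight, Finset.prod_range_succ', Finset.prod_range_succ']
  simp only [cellWeight, geomMesh, pow_zero, pow_one, mul_one]
  split_ifs <;> ring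

lemma meshWeight_nonneg (hf : ∀ k, f k ∈ Icc 0 1) (hy : ∀ m, y m ∈ Icc 0 1) (M : ℕ) (ω : Ω) :
    0 ≤ meshWeight s r q f y M ω :=
  Finset.prod_nonneg fun j _ => (cellWeight_mem_Icc hf hy j _).1

variable [MeasurableSpace Ω] {μ : Measure Ω}

namespace IsUnitRatePoisson

lemma integral_meshWeight (hs : IsUnitRatePoisson μ s) (hr : 0 ≤ r) (hq : 1 ≤ q)
    (f y : ℕ → ℝ) (M : ℕ) :
    ∫ ω, meshWeight s r q f y M ω ∂μ =
      Real.exp (-r) * (∫ ω, f (arrivals s r (r * q) ω) ∂μ) *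
        Real.exp (-(r * ∑ m ∈ Finset.range M, (q ^ (m + 2) - q ^ (m + 1)) * (1 - y m))) := by
  have := hs.isProbabilityMeasure
  have hmesh := monotone_geomMesh hr hq
  have hempty : ∫ ω, (if arrivals s 0 r ω = 0 then (1 : ℝ) else 0) ∂μ = Real.exp (-r) := by
    have h := hs.integral_pow_arrivals le_rfl hr 0
    simpa [zero_pow_eq] using h
  have hpow (m : ℕ) : ∫ ω, y m ^ arrivals s (r * q ^ (m + 1)) (r * q ^ (m + 2)) ω ∂μ =
      Real.exp (-(r * ((q ^ (m + 2) - q ^ (m + 1)) * (1 - y m)))) := by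
    have hcell := hs.integral_pow_arrivals (hmesh (m + 2).zero_le) (hmesh (m + 2).le_succ) (y m)
    simp only [geomMesh] at hcell
    rw [hcell]
    ring_nf
  simp only [meshWeight]
  rw [hs.integral_prod_arrivals le_rfl hmesh, Finset.prod_range_succ', Finset.prod_range_succ']
  simp only [cellWeight, geomMesh, pow_zero, pow_one, mul_one, hempty, hpow,
    ← Real.exp_sum, Finset.sum_neg_distrib, Finset.mul_sum]
  ring

lemma integrable_meshWeight (hs : IsUnitRatePoisson μ s) (hr : 0 ≤ r) (hq : 1 ≤ q)
    (hf : ∀ k, f k ∈ Icc 0 1) (hy : ∀ m, y m ∈ Icc 0 1) (M : ℕ) :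
    Integrable (meshWeight s r q f y M) μ := by
  have := hs.isProbabilityMeasure
  have hmesh := monotone_geomMesh hr hq
  refine .of_bound (C := 1) (Finset.aestronglyMeasurable_fun_prod _ fun j _ => ?_)
    (ae_of_all _ fun ω => ?_)
  · have hcell := hs.hasLaw_arrivals _ _ (hmesh j.zero_le) (hmesh j.le_succ)
    exact (Measurable.of_discrete (f := cellWeight f y j)).comp_aemeasurable
      hcell.aemeasurable |>.aestronglyMeasurable
  · have hweight := cellWeight_mem_Icc hf hy
    rw [Real.norm_of_nonneg (meshWeight_nonneg hf hy M ω)]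
    exact Finset.prod_le_one (fun j _ => (hweight j _).1) fun j _ => (hweight j _).2

lemma ae_first_mem_Ico_iff (hs : IsUnitRatePoisson μ s) (a b : ℝ) :
    ∀ᵐ ω ∂μ, s 0 ω ∈ Ico a b ↔ arrivals s 0 a ω = 0 ∧ arrivals s a b ω ≠ 0 := by
  filter_upwards [hs.monotone, hs.ae_finite a b, hs.ae_arrivals_zero_eq_zero_iff a]
    with ω hmono hfin hzero
  rw [hzero, arrivals, Ne, ncard_eq_zero hfin, ← Ne, ← nonempty_iff_ne_empty, mem_Ico,
    and_congr_right_iff]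
  refine fun ha => ⟨fun hb => ⟨0, ha, hb⟩, fun ⟨n, hn⟩ => ?_⟩
  exact (hmono n.zero_le).trans_lt hn.2

lemma ae_first_two_of_arrivals (hs : IsUnitRatePoisson μ s) (a b : ℝ) :
    ∀ᵐ ω ∂μ, arrivals s 0 a ω = 0 → arrivals s a b ω = 1 → s 0 ω ∈ Ico a b ∧ b ≤ s 1 ω := by
  filter_upwards [hs.monotone, hs.ae_first_mem_Ico_iff a b] with ω hmono hiff hzero hone
  have hmem : s 0 ω ∈ Ico a b := hiff.2 ⟨hzero, hone.trans_ne one_ne_zero⟩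
  refine ⟨hmem, not_lt.1 fun hlt => zero_ne_one (α := ℕ) ?_⟩
  obtain ⟨n, hn⟩ := ncard_eq_one.1 hone
  have huniq {k : ℕ} (hk : s k ω ∈ Ico a b) : k = n := hn.subset hk
  rw [huniq hmem, huniq ⟨hmem.1.trans (hmono zero_le_one), hlt⟩]

lemma measureReal_first_mem_Ico (hs : IsUnitRatePoisson μ s) {a b : ℝ} (ha : 0 ≤ a)
    (hab : a ≤ b) :
    μ.real (s 0 ⁻¹' Ico a b) = Real.exp (-a) * (1 - Real.exp (-(b - a))) := by
  have := hs.isProbabilityMeasure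
  rw [← map_measureReal_apply (hs.measurable 0) measurableSet_Ico, hs.hasLaw_first.map_eq,
    ← Ici_sdiff_Ici, measureReal_sdiff (Ici_subset_Ici.2 hab) measurableSet_Ici,
    expMeasure_real_Ici one_pos ha, expMeasure_real_Ici one_pos (ha.trans hab), mul_sub,
    ← Real.exp_add]
  ring_nf

lemma integral_arrivals_ne_zero (hs : IsUnitRatePoisson μ s) {a b : ℝ} (ha : 0 ≤ a)
    (hab : a ≤ b) :
    ∫ ω, (if arrivals s a b ω = 0 then (0 : ℝ) else 1) ∂μ = 1 - Real.exp (-(b - a)) := by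
  have := hs.isProbabilityMeasure
  have hempty := hs.integral_pow_arrivals ha hab 0
  have hint : Integrable (fun ω => (0 : ℝ) ^ arrivals s a b ω) μ := by
    refine not_imp_comm.1 integral_undef ?_
    rw [hempty]
    positivity
  have hcompl (n : ℕ) : (if n = 0 then (0 : ℝ) else 1) = 1 - 0 ^ n := by
    split_ifs with h <;> simp [h]
  simp_rw [hcompl]
  rw [integral_sub (integrable_const 1) hint, hempty]
  simp

lemma le_integral_arrivals_eq_one (hs : IsUnitRatePoisson μ s) {a b : ℝ} (ha : 0 ≤ a)
    (hab : a ≤ b) :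
    (1 - Real.exp (-(b - a))) * Real.exp (-(b - a)) ≤
      ∫ ω, (if arrivals s a b ω = 1 then (1 : ℝ) else 0) ∂μ := by
  have hone : ∫ ω, (if arrivals s a b ω = 1 then (1 : ℝ) else 0) ∂μ =
      (b - a) * Real.exp (-(b - a)) := by
    have h := (hs.hasLaw_arrivals a b ha hab).integral_comp
      (f := ({1} : Set ℕ).indicator (1 : ℕ → ℝ)) Measurable.of_discrete.aestronglyMeasurable
    rw [integral_indicator_one .of_discrete, poissonMeasure_real_singleton,
      Real.coe_toNNReal _ (sub_nonneg.2 hab)] at h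
    simpa [Pi.single_apply, mul_comm] using h
  rw [hone]
  exact mul_le_mul_of_nonneg_right (by linarith [Real.add_one_le_exp (-(b - a))])
    (Real.exp_nonneg _)

variable {ψ : ℝ → ℝ}

lemma ae_indicator_iInf_noneRetained_le (hs : IsUnitRatePoisson μ s) (hψ : IsRetentionProfile ψ)
    (hr : 0 < r) (hq : 1 ≤ q) (M : ℕ) :
    ∀ᵐ ω ∂μ, (s 0 ⁻¹' Ico r (r * q)).indicator (fun ω => ⨅ n, noneRetained ψ (s · ω) n) ω ≤
      meshWeight s r q (fun k => if k = 0 then 0 else 1) (fun m => 1 - ψ (q ^ (m + 2))) M ω := by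
  filter_upwards [hs.monotone, hs.tendsto_atTop, hs.ae_first_pos,
    hs.ae_first_mem_Ico_iff r (r * q)] with ω hmono htop hpos hiff
  have hy (m : ℕ) : 1 - ψ (q ^ (m + 2)) ∈ Icc 0 1 := hψ.one_sub_mem_Icc (one_le_pow₀ hq)
  by_cases hmem : s 0 ω ∈ Ico r (r * q)
  · obtain ⟨n, hn⟩ := hψ.exists_noneRetained_le_prod_pow hmono htop hr hq hmem M
    have hbdd : BddBelow (range (noneRetained ψ (s · ω))) :=
      ⟨0, forall_mem_range.2 fun k => (hψ.noneRetained_mem_Icc hmono hpos k).1⟩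
    rw [indicator_of_mem (by exact hmem), meshWeight_eq, if_pos (hiff.1 hmem).1,
      if_neg (hiff.1 hmem).2, one_mul]
    exact (ciInf_le hbdd n).trans hn
  · rw [indicator_of_notMem (by exact hmem)]
    exact meshWeight_nonneg (fun k => by split_ifs <;> simp) hy M ω

lemma setIntegral_iInf_noneRetained_le (hs : IsUnitRatePoisson μ s) (hψ : IsRetentionProfile ψ)
    (hr : 0 < r) (hq : 1 ≤ q) (M : ℕ) :
    ∫ ω in s 0 ⁻¹' Ico r (r * q), ⨅ n, noneRetained ψ (s · ω) n ∂μ ≤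
      μ.real (s 0 ⁻¹' Ico r (r * q)) *
        Real.exp (-(r * ∑ m ∈ Finset.range M, (q ^ (m + 2) - q ^ (m + 1)) * ψ (q ^ (m + 2)))) := by
  have hrq : r ≤ r * q := le_mul_of_one_le_right hr.le hq
  have hweight := hs.integral_meshWeight hr.le hq (fun k => if k = 0 then 0 else 1)
    (fun m => 1 - ψ (q ^ (m + 2))) M
  rw [hs.integral_arrivals_ne_zero hr.le hrq, ← hs.measureReal_first_mem_Ico hr.le hrq] at hweight
  simp only [sub_sub_cancel] at hweight
  rw [← hweight, ← integral_indicator (hs.measurable 0 measurableSet_Ico)]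
  refine integral_mono_of_nonneg ?_ (hs.integrable_meshWeight hr.le hq
    (fun k => by split_ifs <;> simp) (fun m => hψ.one_sub_mem_Icc (one_le_pow₀ hq)) M)
    (hs.ae_indicator_iInf_noneRetained_le hψ hr hq M)
  filter_upwards [hs.monotone, hs.ae_first_pos] with ω hmono hpos
  exact indicator_apply_nonneg fun _ =>
    Real.iInf_nonneg fun n => (hψ.noneRetained_mem_Icc hmono hpos n).1

lemma ae_meshWeight_mul_pow_le_noneRetained (hs : IsUnitRatePoisson μ s)
    (hψ : IsRetentionProfile ψ) (hr : 0 < r) (hq : 1 ≤ q) (M n : ℕ) :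
    ∀ᵐ ω ∂μ,
      (1 - ψ (q ^ M)) ^ n *
        meshWeight s r q (fun k => if k = 1 then 1 else 0) (fun m => 1 - ψ (q ^ m)) M ω ≤
      (s 0 ⁻¹' Ico r (r * q)).indicator (fun ω => noneRetained ψ (s · ω) n) ω := by
  filter_upwards [hs.monotone, hs.tendsto_atTop, hs.ae_first_pos,
    hs.ae_first_two_of_arrivals r (r * q)] with ω hmono htop hpos hfirst
  have hnonneg : 0 ≤ (s 0 ⁻¹' Ico r (r * q)).indicator
      (fun ω => noneRetained ψ (s · ω) n) ω :=
    indicator_apply_nonneg fun _ => (hψ.noneRetained_mem_Icc hmono hpos n).1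
  rw [meshWeight_eq]
  split_ifs with hzero hone
  · obtain ⟨hmem, hle⟩ := hfirst hzero hone
    rw [one_mul, indicator_of_mem (by exact hmem)]
    exact hψ.pow_mul_prod_pow_le_noneRetained hmono htop hr hq hmem hle M n
  · simpa using hnonneg
  · simpa using hnonneg

lemma aemeasurable_noneRetained (hs : IsUnitRatePoisson μ s) (hψ : IsRetentionProfile ψ) (n : ℕ) :
    AEMeasurable (fun ω => noneRetained ψ (s · ω) n) μ :=
  (Finset.measurable_fun_prod _ fun k _ => measurable_const.sub
    (hψ.measurable.comp ((hs.measurable (k + 1)).div (hs.measurable 0)))).aemeasurable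

lemma integrable_noneRetained (hs : IsUnitRatePoisson μ s) (hψ : IsRetentionProfile ψ) (n : ℕ) :
    Integrable (fun ω => noneRetained ψ (s · ω) n) μ := by
  have := hs.isProbabilityMeasure
  refine .of_mem_Icc 0 1 (hs.aemeasurable_noneRetained hψ n) ?_
  filter_upwards [hs.monotone, hs.ae_first_pos] with ω hmono hpos
  exact hψ.noneRetained_mem_Icc hmono hpos n

lemma le_setIntegral_noneRetained (hs : IsUnitRatePoisson μ s) (hψ : IsRetentionProfile ψ)
    (hr : 0 < r) (hq : 1 ≤ q) (M n : ℕ) :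
    (1 - ψ (q ^ M)) ^ n * (μ.real (s 0 ⁻¹' Ico r (r * q)) * Real.exp (-(r * (q - 1 +
        ∑ m ∈ Finset.range M, (q ^ (m + 2) - q ^ (m + 1)) * ψ (q ^ m))))) ≤
      ∫ ω in s 0 ⁻¹' Ico r (r * q), noneRetained ψ (s · ω) n ∂μ := by
  have hrq : r ≤ r * q := le_mul_of_one_le_right hr.le hq
  have hy (m : ℕ) : 1 - ψ (q ^ m) ∈ Icc 0 1 := hψ.one_sub_mem_Icc (one_le_pow₀ hq)
  have hf (k : ℕ) : (if k = 1 then (1 : ℝ) else 0) ∈ Icc 0 1 := by split_ifs <;> simp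
  have hset : MeasurableSet (s 0 ⁻¹' Ico r (r * q)) := hs.measurable 0 measurableSet_Ico
  calc
    _ ≤ (1 - ψ (q ^ M)) ^ n * ∫ ω, meshWeight s r q (fun k => if k = 1 then 1 else 0)
          (fun m => 1 - ψ (q ^ m)) M ω ∂μ := by
      refine mul_le_mul_of_nonneg_left ?_ (pow_nonneg (hy M).1 n)
      have hone := hs.le_integral_arrivals_eq_one hr.le hrq
      rw [hs.integral_meshWeight hr.le hq, hs.measureReal_first_mem_Ico hr.le hrq, mul_assoc,
        mul_assoc, mul_add, neg_add, Real.exp_add, ← mul_assoc (1 - _)]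
      simp only [sub_sub_cancel]
      rw [show r * (q - 1) = r * q - r by ring]
      gcongr
    _ ≤ ∫ ω, (s 0 ⁻¹' Ico r (r * q)).indicator (fun ω => noneRetained ψ (s · ω) n) ω ∂μ := by
      rw [← integral_const_mul]
      exact integral_mono_ae ((hs.integrable_meshWeight hr.le hq hf hy M).const_mul _)
        ((hs.integrable_noneRetained hψ n).indicator hset)
        (hs.ae_meshWeight_mul_pow_le_noneRetained hψ hr hq M n)
    _ = _ := integral_indicator hset

end IsUnitRatePoisson

end FirstArrival

section VoidProbability

variable {Ω : Type*} [MeasurableSpace Ω] {μ : Measure Ω}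

lemma integral_le_integral_of_forall_setIntegral_Ico_le {X f g : Ω → ℝ} (hX : Measurable X)
    (hpos : ∀ᵐ ω ∂μ, 0 < X ω) (hf : Integrable f μ) (hg : Integrable g μ) {q : ℝ} (hq : 1 < q)
    (hle : ∀ r, 0 < r →
      ∫ ω in X ⁻¹' Ico r (r * q), f ω ∂μ ≤ ∫ ω in X ⁻¹' Ico r (r * q), g ω ∂μ) :
    ∫ ω, f ω ∂μ ≤ ∫ ω, g ω ∂μ := by
  have hq₀ : 0 < q := one_pos.trans hq
  set cell : ℤ → Set Ω := fun i => X ⁻¹' Ico (q ^ i) (q ^ (i + 1))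
  have hmeas (i : ℤ) : MeasurableSet (cell i) := hX measurableSet_Ico
  have hdisj : Pairwise (Function.onFun Disjoint cell) := fun i j hij =>
    ((zpow_right_mono₀ hq.le).pairwise_disjoint_on_Ico_succ hij).preimage X
  have hcover : ⋃ i, cell i =ᵐ[μ] univ := by
    filter_upwards [hpos] with ω hω
    exact propext (iff_of_true (mem_iUnion.2 (exists_mem_Ico_zpow hω hq)) trivial)
  have hsum {h : Ω → ℝ} (hh : Integrable h μ) :
      HasSum (fun i => ∫ ω in cell i, h ω ∂μ) (∫ ω, h ω ∂μ) := by
    rw [← setIntegral_univ, ← setIntegral_congr_set hcover]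
    exact hasSum_integral_iUnion hmeas hdisj hh.integrableOn
  refine hasSum_le (fun i => ?_) (hsum hf) (hsum hg)
  simp only [cell, zpow_add_one₀ hq₀.ne']
  exact hle _ (zpow_pos hq₀ i)

variable {s : ℕ → Ω → ℝ} {ψ : ℝ → ℝ} {q r : ℝ}

namespace IsUnitRatePoisson

lemma integrable_exp_neg_mul_first (hs : IsUnitRatePoisson μ s) {c : ℝ} (hc : 0 ≤ c) :
    Integrable (fun ω => Real.exp (-(c * s 0 ω))) μ := by
  have := hs.isProbabilityMeasure
  have hmeas := hs.measurable 0
  refine .of_mem_Icc 0 1 (by fun_prop) (ae_of_all _ fun ω => ⟨Real.exp_nonneg _, ?_⟩)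
  exact Real.exp_le_one_iff.2 (neg_nonpos.2 (mul_nonneg hc (hs.nonneg 0 ω)))

lemma integral_exp_neg_mul_first (hs : IsUnitRatePoisson μ s) {c : ℝ} (hc : 0 ≤ c) :
    ∫ ω, Real.exp (-(c * s 0 ω)) ∂μ = 1 / (1 + c) := by
  rw [← integral_exp_neg_mul_expMeasure one_pos hc]
  exact hs.hasLaw_first.integral_comp (f := fun x => Real.exp (-(c * x))) (by fun_prop)

lemma integrable_iInf_noneRetained (hs : IsUnitRatePoisson μ s) (hψ : IsRetentionProfile ψ) :
    Integrable (fun ω => ⨅ n, noneRetained ψ (s · ω) n) μ := by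
  have := hs.isProbabilityMeasure
  refine .of_mem_Icc 0 1 (.iInf (hs.aemeasurable_noneRetained hψ)) ?_
  filter_upwards [hs.monotone, hs.ae_first_pos] with ω hmono hpos
  have hmem := hψ.noneRetained_mem_Icc hmono hpos
  exact ⟨Real.iInf_nonneg fun n => (hmem n).1,
    ciInf_le_of_le ⟨0, forall_mem_range.2 fun n => (hmem n).1⟩ 0 (hmem 0).2⟩

lemma tendsto_integral_noneRetained_iInf (hs : IsUnitRatePoisson μ s)
    (hψ : IsRetentionProfile ψ) :
    Tendsto (fun n => ∫ ω, noneRetained ψ (s · ω) n ∂μ) atTop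
      (nhds (∫ ω, ⨅ n, noneRetained ψ (s · ω) n ∂μ)) := by
  refine integral_tendsto_of_tendsto_of_antitone (hs.integrable_noneRetained hψ)
    (hs.integrable_iInf_noneRetained hψ) ?_ ?_
  all_goals filter_upwards [hs.monotone, hs.ae_first_pos] with ω hmono hpos
  · exact hψ.antitone_noneRetained hmono hpos
  · exact tendsto_atTop_ciInf (hψ.antitone_noneRetained hmono hpos)
      ⟨0, forall_mem_range.2 fun n => (hψ.noneRetained_mem_Icc hmono hpos n).1⟩

lemma setIntegral_iInf_noneRetained_le_exp (hs : IsUnitRatePoisson μ s)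
    (hψ : IsRetentionProfile ψ) (hr : 0 < r) (hq : 1 < q) :
    ∫ ω in s 0 ⁻¹' Ico r (r * q), ⨅ n, noneRetained ψ (s · ω) n ∂μ ≤
      ∫ ω in s 0 ⁻¹' Ico r (r * q),
        Real.exp (-((∫ u in Ioi (q ^ 2), ψ u) / q ^ 2 * s 0 ω)) ∂μ := by
  have := hs.isProbabilityMeasure
  have hq₀ : 0 < q := one_pos.trans hq
  have hψ' : IntegrableOn ψ (Ioi (q ^ 2)) :=
    hψ.integrableOn.mono_set (Ioi_subset_Ioi (one_le_pow₀ hq.le))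
  have hnonneg : 0 ≤ ∫ u in Ioi (q ^ 2), ψ u :=
    setIntegral_nonneg measurableSet_Ioi fun u hu =>
      (hψ.mapsTo ((one_le_pow₀ hq.le).trans (mem_Ioi.1 hu).le)).1
  have hlim : Tendsto (fun M : ℕ => μ.real (s 0 ⁻¹' Ico r (r * q)) *
        Real.exp (-(r * ((∫ u in q ^ 2..q ^ (M + 2), ψ u) / q)))) atTop
      (nhds (μ.real (s 0 ⁻¹' Ico r (r * q)) *
        Real.exp (-(r * ((∫ u in Ioi (q ^ 2), ψ u) / q))))) := by
    have hpow : Tendsto (fun M : ℕ => q ^ (M + 2)) atTop atTop :=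
      (tendsto_pow_atTop_atTop_of_one_lt hq).comp (tendsto_add_atTop_nat 2)
    refine Tendsto.const_mul _ (Real.continuous_exp.tendsto _ |>.comp ?_)
    exact (((intervalIntegral_tendsto_integral_Ioi _ hψ' hpow).div_const q).const_mul r).neg
  refine (ge_of_tendsto' hlim fun M => ?_).trans ?_
  · refine (hs.setIntegral_iInf_noneRetained_le hψ hr hq.le M).trans ?_
    gcongr
    exact (div_le_iff₀' hq₀).2 (hψ.integral_le_sum_geometric hq.le M)
  · rw [mul_comm]
    refine setIntegral_ge_of_const_le_real (hs.measurable 0 measurableSet_Ico)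
      (measure_ne_top _ _) (fun ω hω => ?_)
      (hs.integrable_exp_neg_mul_first (by positivity)).integrableOn
    have hω' : s 0 ω ≤ r * q := hω.2.le
    calc
      _ = Real.exp (-((∫ u in Ioi (q ^ 2), ψ u) / q ^ 2 * (r * q))) := by
        congr 2
        field_simp
      _ ≤ _ := by gcongr

lemma integral_iInf_noneRetained_le (hs : IsUnitRatePoisson μ s) (hψ : IsRetentionProfile ψ)
    (hq : 1 < q) :
    ∫ ω, ⨅ n, noneRetained ψ (s · ω) n ∂μ ≤ 1 / (1 + ∫ u in Ioi 1, ψ u) * q ^ 2 := by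
  have hq₂ : 1 ≤ q ^ 2 := one_le_pow₀ hq.le
  have hcut := hψ.sub_one_le_integral_Ioi hq₂
  have hc := hψ.integral_nonneg
  have hnonneg : 0 ≤ ∫ u in Ioi (q ^ 2), ψ u :=
    setIntegral_nonneg measurableSet_Ioi fun u hu => (hψ.mapsTo (hq₂.trans (mem_Ioi.1 hu).le)).1
  have hnonneg' : 0 ≤ (∫ u in Ioi (q ^ 2), ψ u) / q ^ 2 := by positivity
  calc
    _ ≤ ∫ ω, Real.exp (-((∫ u in Ioi (q ^ 2), ψ u) / q ^ 2 * s 0 ω)) ∂μ :=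
      integral_le_integral_of_forall_setIntegral_Ico_le (hs.measurable 0) hs.ae_first_pos
        (hs.integrable_iInf_noneRetained hψ) (hs.integrable_exp_neg_mul_first hnonneg') hq
        fun r hr => hs.setIntegral_iInf_noneRetained_le_exp hψ hr hq
    _ = q ^ 2 / (q ^ 2 + ∫ u in Ioi (q ^ 2), ψ u) := by
      rw [hs.integral_exp_neg_mul_first hnonneg']
      field_simp
    _ ≤ q ^ 2 / (1 + ∫ u in Ioi 1, ψ u) := by
      exact div_le_div_of_nonneg_left (by positivity) (by positivity) (by linarith)
    _ = _ := by ring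

lemma exp_le_setIntegral_noneRetained (hs : IsUnitRatePoisson μ s) (hψ : IsRetentionProfile ψ)
    (hr : 0 < r) (hq : 1 < q) (n : ℕ) :
    ∫ ω in s 0 ⁻¹' Ico r (r * q),
        Real.exp (-((q ^ 2 * (1 + ∫ u in Ioi 1, ψ u) - 1) * s 0 ω)) ∂μ ≤
      ∫ ω in s 0 ⁻¹' Ico r (r * q), noneRetained ψ (s · ω) n ∂μ := by
  have := hs.isProbabilityMeasure
  set K := q ^ 2 * (1 + ∫ u in Ioi 1, ψ u) - 1
  have hc := hψ.integral_nonneg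
  have hK₀ : 0 ≤ K := by nlinarith [one_le_pow₀ hq.le (n := 2)]
  have hlim : Tendsto (fun M : ℕ => (1 - ψ (q ^ (M + 1))) ^ n *
      (μ.real (s 0 ⁻¹' Ico r (r * q)) * Real.exp (-(r * K)))) atTop
      (nhds (μ.real (s 0 ⁻¹' Ico r (r * q)) * Real.exp (-(r * K)))) := by
    have hpow : Tendsto (fun M : ℕ => q ^ (M + 1)) atTop atTop :=
      (tendsto_pow_atTop_atTop_of_one_lt hq).comp (tendsto_add_atTop_nat 1)
    simpa using (((hψ.tendsto_atTop_zero.comp hpow).const_sub 1).pow n).mul_const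
      (μ.real (s 0 ⁻¹' Ico r (r * q)) * Real.exp (-(r * K)))
  refine le_trans ?_ (le_of_tendsto' hlim fun M => ?_)
  · have hset : MeasurableSet (s 0 ⁻¹' Ico r (r * q)) := hs.measurable 0 measurableSet_Ico
    rw [← smul_eq_mul (μ.real _), ← setIntegral_const]
    refine setIntegral_mono_on (hs.integrable_exp_neg_mul_first hK₀).integrableOn
      (integrableOn_const (measure_ne_top _ _)) hset fun ω hω => ?_
    have hω' : r ≤ s 0 ω := hω.1
    rw [mul_comm r K]
    gcongr
  · refine le_trans ?_ (hs.le_setIntegral_noneRetained hψ hr hq.le (M + 1) n)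
    have hψ₀ := (hψ.one_sub_mem_Icc (one_le_pow₀ hq.le (n := M + 1))).1
    have hsum := hψ.sum_geometric_le hq.le M
    gcongr
    linarith

lemma le_integral_noneRetained (hs : IsUnitRatePoisson μ s) (hψ : IsRetentionProfile ψ)
    (hq : 1 < q) (n : ℕ) :
    1 / (1 + ∫ u in Ioi 1, ψ u) ≤ (∫ ω, noneRetained ψ (s · ω) n ∂μ) * q ^ 2 := by
  have hc := hψ.integral_nonneg
  have hK₀ : 0 ≤ q ^ 2 * (1 + ∫ u in Ioi 1, ψ u) - 1 := by
    nlinarith [one_le_pow₀ hq.le (n := 2)]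
  have hle := integral_le_integral_of_forall_setIntegral_Ico_le (hs.measurable 0) hs.ae_first_pos
    (hs.integrable_exp_neg_mul_first hK₀) (hs.integrable_noneRetained hψ n) hq
    fun r hr => hs.exp_le_setIntegral_noneRetained hψ hr hq n
  rw [hs.integral_exp_neg_mul_first hK₀, add_sub_cancel, mul_comm, ← div_div] at hle
  exact (div_le_iff₀ (by positivity)).1 hle

theorem tendsto_integral_noneRetained (hs : IsUnitRatePoisson μ s) (hψ : IsRetentionProfile ψ) :
    Tendsto (fun n => ∫ ω, noneRetained ψ (s · ω) n ∂μ) atTop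
      (nhds (1 / (1 + ∫ u in Ioi 1, ψ u))) := by
  have hlim := hs.tendsto_integral_noneRetained_iInf hψ
  have hc := hψ.integral_nonneg
  have hsqrt {Q : ℝ} (hQ : 1 < Q) : 1 < √Q ∧ √Q ^ 2 = Q :=
    ⟨Real.lt_sqrt_of_sq_lt (by simpa using hQ), Real.sq_sqrt (by positivity)⟩
  suffices h : ∫ ω, ⨅ n, noneRetained ψ (s · ω) n ∂μ = 1 / (1 + ∫ u in Ioi 1, ψ u) from h ▸ hlim
  refine le_antisymm ((le_iff_forall_one_lt_le_mul₀ (by positivity)).2 fun Q hQ => ?_)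
    ((le_iff_forall_one_lt_le_mul₀ ?_).2 fun Q hQ => ?_)
  · obtain ⟨hq, hqQ⟩ := hsqrt hQ
    simpa only [hqQ] using hs.integral_iInf_noneRetained_le hψ hq
  · refine integral_nonneg_of_ae ?_
    filter_upwards [hs.monotone, hs.ae_first_pos] with ω hmono hpos
    exact Real.iInf_nonneg fun n => (hψ.noneRetained_mem_Icc hmono hpos n).1
  · obtain ⟨hq, hqQ⟩ := hsqrt hQ
    refine ge_of_tendsto' (hlim.mul_const Q) fun n => ?_
    simpa only [hqQ] using hs.le_integral_noneRetained hψ hq n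

end IsUnitRatePoisson

end VoidProbability

section InterferenceFactor

/-- `∫ u > 1, a / (a + u ^ (η / 2))`: the average of `exp (-(a r₀ ^ η / P) I)` over the aggregate
interference `I` and the service distance `r₀` is `1 / (1 + interferenceFactor η a)`. -/
noncomputable def interferenceFactor (η a : ℝ) : ℝ := ∫ u in Ioi (1 : ℝ), a / (a + u ^ (η / 2))

variable {η a : ℝ}

lemma div_add_rpow_le (ha : 0 ≤ a) {u : ℝ} (hu : 0 < u) :
    a / (a + u ^ (η / 2)) ≤ a * u ^ (-(η / 2)) := by
  rw [Real.rpow_neg hu.le, ← div_eq_mul_inv]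
  exact div_le_div_of_nonneg_left ha (Real.rpow_pos_of_pos hu _) (le_add_of_nonneg_left ha)

lemma integrableOn_mul_rpow_neg_half (hη : 2 < η) (a : ℝ) :
    IntegrableOn (fun u : ℝ => a * u ^ (-(η / 2))) (Ioi 1) :=
  (integrableOn_Ioi_rpow_of_lt (by linarith) one_pos).const_mul a

lemma isRetentionProfile_div_add_rpow (hη : 2 < η) (ha : 0 ≤ a) :
    IsRetentionProfile fun u : ℝ => a / (a + u ^ (η / 2)) where
  measurable := by fun_prop
  antitoneOn u hu v _ huv := by
    have hu₀ : 0 < u := one_pos.trans_le hu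
    beta_reduce
    gcongr
  mapsTo u hu := by
    have hu₀ : 0 < u ^ (η / 2) := Real.rpow_pos_of_pos (one_pos.trans_le hu) _
    exact ⟨by positivity, div_le_one_of_le₀ (by linarith) (by positivity)⟩
  integrableOn := by
    refine (integrableOn_mul_rpow_neg_half hη a).mono'
      (Measurable.aestronglyMeasurable (by fun_prop)) ?_
    filter_upwards [ae_restrict_mem measurableSet_Ioi] with u hu
    have hu₀ : 0 < u := one_pos.trans hu
    rw [Real.norm_of_nonneg (by positivity)]
    exact div_add_rpow_le ha hu₀

lemma interferenceFactor_nonneg (hη : 2 < η) (ha : 0 ≤ a) : 0 ≤ interferenceFactor η a :=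
  (isRetentionProfile_div_add_rpow hη ha).integral_nonneg

lemma tendsto_interferenceFactor_zero (hη : 2 < η) :
    Tendsto (interferenceFactor η) (nhdsWithin 0 (Ioi 0)) (nhds 0) := by
  have hbound : ∀ᶠ a in nhdsWithin (0 : ℝ) (Ioi 0),
      interferenceFactor η a ≤ a * ∫ u in Ioi (1 : ℝ), u ^ (-(η / 2)) := by
    filter_upwards [self_mem_nhdsWithin] with a ha
    rw [interferenceFactor, ← integral_const_mul]
    exact setIntegral_mono_on (isRetentionProfile_div_add_rpow hη (le_of_lt ha)).integrableOn
      (integrableOn_mul_rpow_neg_half hη a) measurableSet_Ioi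
      fun u hu => div_add_rpow_le (le_of_lt ha) (one_pos.trans hu)
  have hlim : Tendsto (fun a : ℝ => a * ∫ u in Ioi (1 : ℝ), u ^ (-(η / 2)))
      (nhdsWithin 0 (Ioi 0)) (nhds 0) := by
    simpa using (tendsto_nhdsWithin_of_tendsto_nhds (tendsto_id (x := nhds (0 : ℝ)))).mul_const
      (∫ u in Ioi (1 : ℝ), u ^ (-(η / 2)))
  refine tendsto_of_tendsto_of_tendsto_of_le_of_le' tendsto_const_nhds hlim ?_ hbound
  filter_upwards [self_mem_nhdsWithin] with a ha using interferenceFactor_nonneg hη (le_of_lt ha)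

lemma interferenceFactor_four (ha : 0 ≤ a) : interferenceFactor 4 a = √a * Real.arctan √a := by
  obtain rfl | ha := ha.eq_or_lt
  · simp [interferenceFactor]
  have hsqrt : 0 < √a := Real.sqrt_pos.2 ha
  have hcomp (u : ℝ) : a / (a + u ^ ((4 : ℝ) / 2)) = (1 + ((√a)⁻¹ * u) ^ 2)⁻¹ := by
    rw [show (4 : ℝ) / 2 = (2 : ℕ) by norm_num, Real.rpow_natCast, mul_pow, inv_pow,
      Real.sq_sqrt ha.le]
    field_simp
  simp_rw [interferenceFactor, hcomp]
  rw [integral_comp_mul_left_Ioi (fun u => (1 + u ^ 2)⁻¹) 1 (inv_pos.2 hsqrt), mul_one, inv_inv,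
    integral_Ioi_inv_one_add_sq, Real.arctan_inv_of_pos hsqrt, sub_sub_cancel, smul_eq_mul]

lemma setIntegral_interferenceFactor_four {β : ℝ} (hβ : 0 < β) (k : ℝ → ℝ) :
    ∫ z in Ioi (0 : ℝ), k z * (1 / (1 + interferenceFactor 4 (z / β))) =
      ∫ z in Ioi (0 : ℝ), k z * (1 / (1 + √(z / β) * Real.arctan √(z / β))) :=
  setIntegral_congr_fun measurableSet_Ioi fun z hz => by
    rw [interferenceFactor_four (div_nonneg (le_of_lt hz) hβ.le)]

end InterferenceFactor

section LaplaceTransform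

variable {Ω : Type*} [MeasurableSpace Ω] {μ : Measure Ω} {f : ℕ → Ω → ℝ}

lemma measurableSet_summable (hf : ∀ k, Measurable (f k)) (hf₀ : ∀ k ω, 0 ≤ f k ω) :
    MeasurableSet {ω | Summable fun k => f k ω} := by
  have hset : {ω | Summable fun k => f k ω} =
      {ω | BddAbove (range fun n => ∑ k ∈ Finset.range n, f k ω)} := by
    ext ω
    refine ⟨fun hsum => ⟨∑' k, f k ω, forall_mem_range.2 fun n => ?_⟩, fun ⟨c, hc⟩ => ?_⟩
    · exact hsum.sum_le_tsum _ fun k _ => hf₀ k ω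
    · exact summable_of_sum_range_le (fun k => hf₀ k ω) fun n => hc ⟨n, rfl⟩
  rw [hset]
  exact measurableSet_bddAbove_range fun n => Finset.measurable_fun_sum _ fun k _ => hf k

lemma tendsto_integral_exp_neg_mul_sum [IsFiniteMeasure μ] (hf : ∀ k, Measurable (f k))
    (hf₀ : ∀ k ω, 0 ≤ f k ω) {a : ℝ} (ha : 0 < a) :
    Tendsto (fun n => ∫ ω, Real.exp (-(a * ∑ k ∈ Finset.range n, f k ω)) ∂μ) atTop
      (nhds (∫ ω in {ω | Summable fun k => f k ω}, Real.exp (-(a * ∑' k, f k ω)) ∂μ)) := by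
  rw [← integral_indicator (measurableSet_summable hf hf₀)]
  refine tendsto_integral_of_dominated_convergence 1
    (fun n => Measurable.aestronglyMeasurable (by fun_prop)) (integrable_const 1)
    (fun n => ae_of_all _ fun ω => ?_) (ae_of_all _ fun ω => ?_)
  · rw [Real.norm_of_nonneg (Real.exp_nonneg _)]
    exact Real.exp_le_one_iff.2 (neg_nonpos.2
      (mul_nonneg ha.le (Finset.sum_nonneg fun k _ => hf₀ k ω)))
  · by_cases hsum : Summable fun k => f k ω
    · rw [indicator_of_mem (by exact hsum)]
      exact (Real.continuous_exp.tendsto _).comp (hsum.hasSum.tendsto_sum_nat.const_mul a).neg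
    · rw [indicator_of_notMem (by exact hsum)]
      have htop := (not_summable_iff_tendsto_nat_atTop_of_nonneg fun k => hf₀ k ω).1 hsum
      exact Real.tendsto_exp_neg_atTop_nhds_zero.comp (htop.const_mul_atTop ha)

variable [IsProbabilityMeasure μ] {L : ℝ → ℝ}

lemma ae_summable_of_tendsto_integral_exp (hf : ∀ k, Measurable (f k)) (hf₀ : ∀ k ω, 0 ≤ f k ω)
    (hL : ∀ a, 0 < a → Tendsto
      (fun n => ∫ ω, Real.exp (-(a * ∑ k ∈ Finset.range n, f k ω)) ∂μ) atTop (nhds (L a)))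
    (hL₀ : Tendsto L (nhdsWithin 0 (Ioi 0)) (nhds 1)) :
    ∀ᵐ ω ∂μ, Summable fun k => f k ω := by
  have hset := measurableSet_summable hf hf₀
  have hle : ∀ᶠ a in nhdsWithin (0 : ℝ) (Ioi 0), L a ≤ μ.real {ω | Summable fun k => f k ω} := by
    filter_upwards [self_mem_nhdsWithin] with a ha
    rw [tendsto_nhds_unique (hL a ha) (tendsto_integral_exp_neg_mul_sum hf hf₀ ha),
      ← mul_one (μ.real _), ← smul_eq_mul, ← setIntegral_const]
    refine integral_mono_of_nonneg (ae_of_all _ fun ω => Real.exp_nonneg _) (integrable_const 1)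
      (ae_of_all _ fun ω => ?_)
    exact Real.exp_le_one_iff.2 (neg_nonpos.2
      (mul_nonneg (le_of_lt ha) (tsum_nonneg fun k => hf₀ k ω)))
  have hone := le_antisymm measureReal_le_one (le_of_tendsto hL₀ hle)
  exact (mem_ae_iff_prob_eq_one hset).2 ((ENNReal.toReal_eq_one_iff _).1 hone)

lemma integral_exp_neg_mul_tsum (hf : ∀ k, Measurable (f k)) (hf₀ : ∀ k ω, 0 ≤ f k ω)
    (hsum : ∀ᵐ ω ∂μ, Summable fun k => f k ω) {a l : ℝ} (ha : 0 < a)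
    (hl : Tendsto (fun n => ∫ ω, Real.exp (-(a * ∑ k ∈ Finset.range n, f k ω)) ∂μ) atTop
      (nhds l)) :
    ∫ ω, Real.exp (-(a * ∑' k, f k ω)) ∂μ = l := by
  rw [tendsto_nhds_unique hl (tendsto_integral_exp_neg_mul_sum hf hf₀ ha),
    Measure.restrict_eq_self_of_ae_mem (by exact hsum)]

end LaplaceTransform

/-! ### Interference and coverage -/

section RelativePower

variable {Ω : Type*} {X : ℕ → Ω → Plane} {h : ℕ → Ω → ℂ} {P η : ℝ} {ω : Ω}

/-- Power received from the interferer `X (k + 1)`, relative to the mean power received from the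
serving BS `X 0`. -/
noncomputable def relPower (η : ℝ) (X : ℕ → Ω → Plane) (h : ℕ → Ω → ℂ) (k : ℕ) (ω : Ω) : ℝ :=
  (‖X 0 ω‖ / ‖X (k + 1) ω‖) ^ η * ‖h (k + 1) ω‖ ^ 2

lemma relPower_nonneg (η : ℝ) (X : ℕ → Ω → Plane) (h : ℕ → Ω → ℂ) (k : ℕ) (ω : Ω) :
    0 ≤ relPower η X h k ω := by
  unfold relPower
  positivity

lemma rxPower_succ_eq (hr : 0 < serviceDist X ω) (k : ℕ) :
    rxPower P η X h (k + 1) ω = P * serviceDist X ω ^ (-η) * relPower η X h k ω := by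
  have hpow : serviceDist X ω ^ η ≠ 0 := (Real.rpow_pos_of_pos hr η).ne'
  rw [rxPower, relPower, ← serviceDist, Real.div_rpow hr.le (norm_nonneg _), Real.rpow_neg hr.le,
    Real.rpow_neg (norm_nonneg _)]
  field_simp

lemma summable_rxPower_succ (hr : 0 < serviceDist X ω)
    (hsum : Summable fun k => relPower η X h k ω) :
    Summable fun k => rxPower P η X h (k + 1) ω := by
  simpa only [rxPower_succ_eq hr] using hsum.mul_left _

lemma interference_eq (hr : 0 < serviceDist X ω) :
    interference P η X h ω = P * serviceDist X ω ^ (-η) * ∑' k, relPower η X h k ω := by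
  simp_rw [interference, rxPower_succ_eq hr, tsum_mul_left]

lemma mul_interference_eq (hP : P ≠ 0) (hr : 0 < serviceDist X ω) (a : ℝ) :
    a * serviceDist X ω ^ η / P * interference P η X h ω = a * ∑' k, relPower η X h k ω := by
  have hpow : serviceDist X ω ^ η ≠ 0 := (Real.rpow_pos_of_pos hr η).ne'
  rw [interference_eq hr, Real.rpow_neg hr.le]
  field_simp

lemma sinr_zero_eq (hP : P ≠ 0) (hr : 0 < serviceDist X ω) :
    sinr P η 0 X h ω = ‖h 0 ω‖ ^ 2 / ∑' k, relPower η X h k ω := by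
  have hpow : P * serviceDist X ω ^ (-η) ≠ 0 :=
    mul_ne_zero hP (Real.rpow_pos_of_pos hr (-η)).ne'
  rw [sinr, add_zero, interference_eq hr, rxPower, ← serviceDist, mul_right_comm,
    mul_div_mul_left _ _ hpow]

lemma one_sub_div_add_rpow_normalizedArea {lam a : ℝ} (hlam : 0 < lam) (ha : 0 ≤ a) {x y : Plane}
    (hx : 0 < ‖x‖) (hy : 0 < ‖y‖) :
    1 - a / (a + (normalizedArea lam y / normalizedArea lam x) ^ (η / 2)) =
      1 / (1 + a * (‖x‖ / ‖y‖) ^ η) := by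
  have hratio : (normalizedArea lam y / normalizedArea lam x) ^ (η / 2) = (‖y‖ / ‖x‖) ^ η := by
    rw [normalizedArea, normalizedArea, mul_div_mul_left _ _ (mul_pos Real.pi_pos hlam).ne',
      ← div_pow, ← Real.rpow_natCast_mul (by positivity)]
    congr 1
    push_cast
    ring
  rw [hratio, ← inv_div ‖y‖ ‖x‖, Real.inv_rpow (by positivity)]
  field_simp
  ring

end RelativePower

namespace IsDownlinkNetwork

variable {Ω : Type*} [MeasurableSpace Ω] {μ : Measure Ω} {lam P η a : ℝ} {X : ℕ → Ω → Plane}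
  {h : ℕ → Ω → ℂ}

lemma measurable_relPower (hnet : IsDownlinkNetwork μ lam X h) (k : ℕ) :
    Measurable (relPower η X h k) := by
  have hX := hnet.ppp.measurable
  have hh := hnet.fading_measurable
  unfold relPower
  fun_prop

lemma measurable_interference (hnet : IsDownlinkNetwork μ lam X h) :
    Measurable (interference P η X h) := by
  have hX := hnet.ppp.measurable
  have hh := hnet.fading_measurable
  exact Measurable.tsum fun k => by unfold rxPower; fun_prop

lemma measurable_sinr {N₀ : ℝ} (hnet : IsDownlinkNetwork μ lam X h) :
    Measurable (sinr P η N₀ X h) := by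
  have hX := hnet.ppp.measurable 0
  have hh := hnet.fading_measurable 0
  have hI := hnet.measurable_interference (P := P) (η := η)
  unfold sinr rxPower
  fun_prop

lemma isUnitRatePoisson (hnet : IsDownlinkNetwork μ lam X h) (hlam : 0 < lam) :
    IsUnitRatePoisson μ fun n ω => normalizedArea lam (X n ω) :=
  hnet.ppp.isUnitRatePoisson hlam hnet.ordered

lemma ae_serviceDist_pos (hnet : IsDownlinkNetwork μ lam X h) (hlam : 0 < lam) :
    ∀ᵐ ω ∂μ, 0 < serviceDist X ω := by
  filter_upwards [(hnet.isUnitRatePoisson hlam).ae_first_pos] with ω hω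
  refine (norm_nonneg _).lt_of_ne' fun h₀ => hω.ne' ?_
  rw [normalizedArea, h₀]
  ring

variable [IsProbabilityMeasure μ]

lemma integral_exp_neg_mul_sum_relPower (hnet : IsDownlinkNetwork μ lam X h) (hlam : 0 < lam)
    (ha : 0 ≤ a) (n : ℕ) :
    ∫ ω, Real.exp (-(a * ∑ k ∈ Finset.range n, relPower η X h k ω)) ∂μ =
      ∫ ω, noneRetained (fun u => a / (a + u ^ (η / 2)))
        (fun n => normalizedArea lam (X n ω)) n ∂μ := by
  have hfading := integral_exp_neg_sum_mul_norm_sq_of_indepFun hnet.fading_measurable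
    hnet.fading_law hnet.fading_indep (measurable_pi_lambda _ hnet.ppp.measurable)
    hnet.fading_indep_ppp n (c := fun k x => a * (‖x 0‖ / ‖x (k + 1)‖) ^ η)
    (fun k => by fun_prop) (fun k x => by positivity)
  simp_rw [relPower, Finset.mul_sum, ← mul_assoc]
  rw [hfading]
  refine integral_congr_ae ?_
  filter_upwards [hnet.ordered, hnet.ae_serviceDist_pos hlam] with ω hmono hpos
  refine Finset.prod_congr rfl fun k _ => ?_
  exact (one_sub_div_add_rpow_normalizedArea hlam ha hpos
    (hpos.trans_le (hmono (k + 1).zero_le))).symm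

lemma tendsto_integral_exp_neg_mul_sum_relPower (hnet : IsDownlinkNetwork μ lam X h)
    (hlam : 0 < lam) (hη : 2 < η) (ha : 0 ≤ a) :
    Tendsto (fun n => ∫ ω, Real.exp (-(a * ∑ k ∈ Finset.range n, relPower η X h k ω)) ∂μ) atTop
      (nhds (1 / (1 + interferenceFactor η a))) := by
  simp_rw [hnet.integral_exp_neg_mul_sum_relPower hlam ha]
  exact (hnet.isUnitRatePoisson hlam).tendsto_integral_noneRetained
    (isRetentionProfile_div_add_rpow hη ha)

lemma ae_summable_relPower (hnet : IsDownlinkNetwork μ lam X h) (hlam : 0 < lam) (hη : 2 < η) :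
    ∀ᵐ ω ∂μ, Summable fun k => relPower η X h k ω := by
  refine ae_summable_of_tendsto_integral_exp hnet.measurable_relPower
    (fun k => relPower_nonneg η X h k)
    (fun a ha => hnet.tendsto_integral_exp_neg_mul_sum_relPower hlam hη (le_of_lt ha)) ?_
  simpa using ((tendsto_interferenceFactor_zero hη).const_add 1).inv₀ (by simp)

theorem ae_summable_rxPower (hnet : IsDownlinkNetwork μ lam X h) (hlam : 0 < lam) (hη : 2 < η) :
    ∀ᵐ ω ∂μ, Summable fun k => rxPower P η X h (k + 1) ω := by
  filter_upwards [hnet.ae_serviceDist_pos hlam, hnet.ae_summable_relPower hlam hη] with ω hr hsum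
  exact summable_rxPower_succ hr hsum

lemma integral_exp_neg_mul_tsum_relPower (hnet : IsDownlinkNetwork μ lam X h) (hlam : 0 < lam)
    (hη : 2 < η) (ha : 0 ≤ a) :
    ∫ ω, Real.exp (-(a * ∑' k, relPower η X h k ω)) ∂μ = 1 / (1 + interferenceFactor η a) := by
  rcases ha.eq_or_lt with rfl | ha
  · simp [interferenceFactor]
  · exact integral_exp_neg_mul_tsum hnet.measurable_relPower (fun k => relPower_nonneg η X h k)
      (hnet.ae_summable_relPower hlam hη) ha
      (hnet.tendsto_integral_exp_neg_mul_sum_relPower hlam hη ha.le)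

theorem integral_exp_neg_mul_interference (hnet : IsDownlinkNetwork μ lam X h) (hlam : 0 < lam)
    (hP : P ≠ 0) (hη : 2 < η) (ha : 0 ≤ a) :
    ∫ ω, Real.exp (-(a * serviceDist X ω ^ η / P * interference P η X h ω)) ∂μ =
      1 / (1 + interferenceFactor η a) := by
  rw [← hnet.integral_exp_neg_mul_tsum_relPower hlam hη ha]
  refine integral_congr_ae ?_
  filter_upwards [hnet.ae_serviceDist_pos hlam] with ω hr
  rw [mul_interference_eq hP hr]

lemma ae_tsum_relPower_pos (hnet : IsDownlinkNetwork μ lam X h) (hlam : 0 < lam) (hη : 2 < η) :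
    ∀ᵐ ω ∂μ, 0 < ∑' k, relPower η X h k ω := by
  have hfading : ∀ᵐ ω ∂μ, ‖h 1 ω‖ ^ 2 ≠ 0 :=
    ((hasLaw_norm_sq_of_complexGaussian (hnet.fading_law 1)).ae_iff
      (p := (· ≠ 0)) (by fun_prop)).2 (Measure.ae_ne _ 0)
  filter_upwards [hnet.ordered, hnet.ae_serviceDist_pos hlam, hnet.ae_summable_relPower hlam hη,
    hfading] with ω hmono hpos hsum hfading
  have hpos₁ : 0 < ‖X 1 ω‖ := hpos.trans_le (hmono zero_le_one)
  exact hsum.tsum_pos (fun k => relPower_nonneg η X h k ω) 0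
    (mul_pos (Real.rpow_pos_of_pos (div_pos hpos hpos₁) η) ((sq_nonneg _).lt_of_ne' hfading))

theorem measureReal_le_sinr (hnet : IsDownlinkNetwork μ lam X h) (hlam : 0 < lam) (hP : P ≠ 0)
    (hη : 2 < η) (ha : 0 ≤ a) :
    μ.real {ω | a ≤ sinr P η 0 X h ω} = 1 / (1 + interferenceFactor η a) := by
  have hfading : μ.real {ω | a * ∑' k, relPower η X h k ω ≤ ‖h 0 ω‖ ^ 2} =
      ∫ ω, Real.exp (-(a * ∑' k, relPower η X h k ω)) ∂μ := by
    simp_rw [relPower, ← tsum_mul_left, ← mul_assoc]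
    exact measureReal_tsum_mul_norm_sq_le_norm_sq_of_indepFun hnet.fading_measurable
      hnet.fading_law hnet.fading_indep (measurable_pi_lambda _ hnet.ppp.measurable)
      hnet.fading_indep_ppp (c := fun k x => a * (‖x 0‖ / ‖x (k + 1)‖) ^ η)
      (fun k => by fun_prop) (fun k x => by positivity)
  rw [← hnet.integral_exp_neg_mul_tsum_relPower hlam hη ha, ← hfading]
  refine measureReal_congr ?_
  filter_upwards [hnet.ae_serviceDist_pos hlam, hnet.ae_tsum_relPower_pos hlam hη] with ω hr hV
  refine propext ?_
  change a ≤ sinr P η 0 X h ω ↔ a * ∑' k, relPower η X h k ω ≤ ‖h 0 ω‖ ^ 2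
  rw [sinr_zero_eq hP hr, le_div_iff₀ hV]

theorem outage_eq (hnet : IsDownlinkNetwork μ lam X h) (hlam : 0 < lam) (hP : P ≠ 0)
    (hη : 2 < η) (ha : 0 ≤ a) :
    outage μ (sinr P η 0 X h) a = 1 - 1 / (1 + interferenceFactor η a) := by
  have hle : MeasurableSet {ω | a ≤ sinr P η 0 X h ω} :=
    measurableSet_le measurable_const hnet.measurable_sinr
  rw [← hnet.measureReal_le_sinr hlam hP hη ha, ← probReal_compl_eq_one_sub hle, outage,
    compl_ofPred]
  simp only [not_le]

end IsDownlinkNetwork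

section ConditionalLaplaceTransform

variable {Ω : Type*} [MeasurableSpace Ω] {μ : Measure Ω} {lam P η : ℝ} {X : ℕ → Ω → Plane}
  {h : ℕ → Ω → ℂ}

lemma integral_condLT [IsFiniteMeasure μ] (hX : Measurable (serviceDist X))
    (hI : Measurable (interference P η X h)) {z : ℝ → ℝ} (hz : Measurable z)
    (hint : Integrable
      (fun ω => Real.exp (-(z (serviceDist X ω) * interference P η X h ω))) μ) :
    ∫ r, condLT μ P η X h (z r) r ∂μ.map (serviceDist X) =
      ∫ ω, Real.exp (-(z (serviceDist X ω) * interference P η X h ω)) ∂μ := by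
  let F (p : ℝ × ℝ) : ℝ := Real.exp (-(z p.1 * p.2))
  have hF : Measurable F := by fun_prop
  have hXI := hX.prodMk hI
  have hmap := compProd_map_condDistrib (mβ := Real.measurableSpace) (X := serviceDist X)
    (μ := μ) hI.aemeasurable
  have hFint : Integrable F (μ.map fun ω => (serviceDist X ω, interference P η X h ω)) :=
    (integrable_map_measure hF.aestronglyMeasurable hXI.aemeasurable).2 hint
  rw [← integral_map (f := F) hXI.aemeasurable hF.aestronglyMeasurable, ← hmap,
    Measure.integral_compProd (hmap ▸ hFint)]
  rfl

lemma IsPPP.integral_map_serviceDist (hX : IsPPP μ lam X) (hlam : 0 < lam)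
    (hmono : ∀ᵐ ω ∂μ, Monotone fun n => ‖X n ω‖) (f : ℝ → ℝ) :
    ∫ r, f r ∂μ.map (serviceDist X) =
      ∫ r in Ioi (0 : ℝ), 2 * Real.pi * lam * r * Real.exp (-(Real.pi * lam * r ^ 2)) * f r := by
  rw [hX.map_serviceDist hlam hmono, integral_withDensity_eq_integral_toReal_smul (by fun_prop)
    (ae_of_all _ fun _ => ENNReal.ofReal_lt_top)]
  refine setIntegral_congr_fun measurableSet_Ioi fun r hr => ?_
  have hr₀ : 0 < r := hr
  simp only [smul_eq_mul]
  rw [ENNReal.toReal_ofReal (by positivity)]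

theorem IsDownlinkNetwork.integral_condLT [IsProbabilityMeasure μ]
    (hnet : IsDownlinkNetwork μ lam X h) (hlam : 0 < lam) (hP : P ≠ 0) (hη : 2 < η) {a : ℝ}
    (ha : 0 ≤ a) :
    ∫ r in Ioi (0 : ℝ), 2 * Real.pi * lam * r * Real.exp (-(Real.pi * lam * r ^ 2)) *
        condLT μ P η X h (a * r ^ η / P) r = 1 / (1 + interferenceFactor η a) := by
  have hI := hnet.measurable_interference (P := P) (η := η)
  have hX : Measurable (serviceDist X) := (hnet.ppp.measurable 0).norm
  rw [← hnet.ppp.integral_map_serviceDist hlam hnet.ordered fun r =>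
    condLT μ P η X h (a * r ^ η / P) r, ← hnet.integral_exp_neg_mul_interference hlam hP hη ha]
  refine Cellular.integral_condLT (z := fun r => a * r ^ η / P) hX hI (by fun_prop) ?_
  refine .of_bound (Measurable.aestronglyMeasurable (by fun_prop)) 1 ?_
  filter_upwards [hnet.ae_serviceDist_pos hlam] with ω hr
  rw [mul_interference_eq hP hr, Real.norm_eq_abs, Real.abs_exp, Real.exp_le_one_iff, neg_nonpos]
  exact mul_nonneg ha (tsum_nonneg fun k => relPower_nonneg η X h k ω)

lemma integral_rayleigh_mul_add_one (hlam : 0 < lam) {c : ℝ} (hc : 0 ≤ c) :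
    ∫ r in Ioi (0 : ℝ), 2 * Real.pi * lam * r * Real.exp (-(Real.pi * lam * r ^ 2 * (c + 1))) =
      1 / (1 + c) := by
  rw [← integral_exp_neg_mul_expMeasure one_pos hc, ← integral_rayleigh (mul_pos Real.pi_pos hlam)]
  refine integral_congr_ae (ae_of_all _ fun r => ?_)
  beta_reduce
  rw [mul_assoc _ (Real.exp _), ← Real.exp_add]
  ring_nf

end ConditionalLaplaceTransform

/-! ### Symbol error probability -/

section ErrorFunction

lemma erfc_nonneg (x : ℝ) : 0 ≤ erfc x :=
  mul_nonneg (by positivity) (integral_nonneg fun _ => Real.exp_nonneg _)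

lemma erfc_zero : erfc 0 = 1 := by
  have hgauss := integral_gaussian_Ioi 1
  simp only [neg_mul, one_mul, div_one] at hgauss
  have hpi : √Real.pi ≠ 0 := (Real.sqrt_pos.2 Real.pi_pos).ne'
  rw [erfc, hgauss]
  field_simp

lemma erfc_eq_one_sub (x : ℝ) :
    erfc x = 1 - 2 / √Real.pi * ∫ t in (0 : ℝ)..x, Real.exp (-t ^ 2) := by
  have hint : Integrable fun t : ℝ => Real.exp (-t ^ 2) := by
    simpa using integrable_exp_neg_mul_sq one_pos
  rw [← erfc_zero, erfc, erfc,
    ← intervalIntegral.integral_Ioi_sub_Ioi' hint.integrableOn hint.integrableOn]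
  ring

lemma erfc_le_one {x : ℝ} (hx : 0 ≤ x) : erfc x ≤ 1 := by
  rw [erfc_eq_one_sub]
  exact sub_le_self _ (mul_nonneg (by positivity)
    (intervalIntegral.integral_nonneg hx fun _ _ => Real.exp_nonneg _))

lemma hasDerivAt_erfc (x : ℝ) : HasDerivAt erfc (-(2 / √Real.pi * Real.exp (-x ^ 2))) x := by
  have hcont : Continuous fun t : ℝ => Real.exp (-t ^ 2) := by fun_prop
  rw [funext erfc_eq_one_sub]
  exact ((hcont.integral_hasStrictDerivAt 0 x).hasDerivAt.const_mul _).const_sub 1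

lemma continuous_erfc_sqrt : Continuous fun x => erfc √x :=
  (continuous_iff_continuousAt.2 fun x => (hasDerivAt_erfc x).continuousAt).comp
    Real.continuous_sqrt

lemma hasDerivAt_erfc_sqrt {x : ℝ} (hx : 0 < x) :
    HasDerivAt (fun x => erfc √x) (-(1 / √Real.pi * (Real.exp (-x) / √x))) x := by
  refine ((hasDerivAt_erfc √x).comp x (Real.hasDerivAt_sqrt hx.ne')).congr_deriv ?_
  rw [Real.sq_sqrt hx.le]
  have hsqrt : √x ≠ 0 := (Real.sqrt_pos.2 hx).ne'
  field_simp

lemma integrableOn_exp_neg_div_sqrt :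
    IntegrableOn (fun z => Real.exp (-z) / √z) (Ioi (0 : ℝ)) := by
  refine (Real.GammaIntegral_convergent one_half_pos).congr_fun (fun z hz => ?_) measurableSet_Ioi
  beta_reduce
  rw [show (1 / 2 - 1 : ℝ) = -(1 / 2) by norm_num, Real.rpow_neg (le_of_lt hz),
    ← Real.sqrt_eq_rpow, ← div_eq_mul_inv]

lemma integrableOn_exp_neg_mul_erfc_div_sqrt :
    IntegrableOn (fun z => Real.exp (-z) * erfc √z / √z) (Ioi (0 : ℝ)) := by
  have hmul := integrableOn_exp_neg_div_sqrt.bdd_mul (c := 1)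
    continuous_erfc_sqrt.aestronglyMeasurable (ae_of_all _ fun z => by
      rw [Real.norm_of_nonneg (erfc_nonneg _)]
      exact erfc_le_one (Real.sqrt_nonneg z))
  refine hmul.congr (ae_of_all _ fun z => ?_)
  ring

lemma eq_one_sub_integral_of_hasDerivAt_neg {G k : ℝ → ℝ} (hG : Continuous G) (hG₀ : G 0 = 1)
    (hderiv : ∀ z, 0 < z → HasDerivAt G (-k z) z) (hk : IntegrableOn k (Ioi 0)) {x : ℝ}
    (hx : 0 ≤ x) : G x = 1 - ∫ z in Ioc 0 x, k z := by
  have hftc := intervalIntegral.integral_eq_sub_of_hasDerivAt_of_le hx hG.continuousOn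
    (fun z hz => hderiv z hz.1) ((intervalIntegrable_iff_integrableOn_Ioc_of_le hx).2
      (hk.mono_set Ioc_subset_Ioi_self).neg)
  rw [intervalIntegral.integral_of_le hx, integral_neg, hG₀] at hftc
  linarith

end ErrorFunction

section TailFormula

variable {Ω : Type*} [MeasurableSpace Ω] {μ : Measure Ω} {Y : Ω → ℝ}

lemma integrable_and_integral_setIntegral_Ioc [IsFiniteMeasure μ] (hY : Measurable Y) {k : ℝ → ℝ}
    (hk : IntegrableOn k (Ioi 0)) :
    Integrable (fun ω => ∫ z in Ioc 0 (Y ω), k z) μ ∧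
      ∫ ω, (∫ z in Ioc 0 (Y ω), k z) ∂μ = ∫ z in Ioi (0 : ℝ), k z * μ.real {ω | z ≤ Y ω} := by
  let D : Set (Ω × ℝ) := {p | p.2 ≤ Y p.1}
  have hD : MeasurableSet D := measurableSet_le measurable_snd (hY.comp measurable_fst)
  have hint : Integrable (D.indicator fun p => k p.2) (μ.prod (volume.restrict (Ioi 0))) :=
    (Integrable.comp_snd (ν := volume.restrict (Ioi 0)) hk μ).indicator hD
  have hfst (ω : Ω) :
      ∫ z in Ioc 0 (Y ω), k z = ∫ z in Ioi (0 : ℝ), D.indicator (fun p => k p.2) (ω, z) := by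
    rw [← Ioi_inter_Iic, inter_comm, ← Measure.restrict_restrict measurableSet_Iic,
      ← integral_indicator measurableSet_Iic]
    rfl
  have hsnd (z : ℝ) : ∫ ω, D.indicator (fun p => k p.2) (ω, z) ∂μ = k z * μ.real {ω | z ≤ Y ω} := by
    rw [mul_comm, ← smul_eq_mul (μ.real _), ← setIntegral_const,
      ← integral_indicator (measurableSet_le measurable_const hY)]
    rfl
  simp_rw [hfst, ← hsnd]
  exact ⟨hint.integral_prod_left, integral_integral_swap
    (f := fun ω z => D.indicator (fun p => k p.2) (ω, z)) hint⟩

lemma integral_comp_mul_eq_one_sub [IsProbabilityMeasure μ] (hY : Measurable Y)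
    (hY₀ : ∀ᵐ ω ∂μ, 0 ≤ Y ω) {G k : ℝ → ℝ} (hk : IntegrableOn k (Ioi 0))
    (hG : ∀ x, 0 ≤ x → G x = 1 - ∫ z in Ioc 0 x, k z) {β : ℝ} (hβ : 0 < β) :
    ∫ ω, G (β * Y ω) ∂μ = 1 - ∫ z in Ioi (0 : ℝ), k z * μ.real {ω | z / β ≤ Y ω} := by
  obtain ⟨hint, heq⟩ := integrable_and_integral_setIntegral_Ioc (μ := μ) (hY.const_mul β) hk
  simp_rw [div_le_iff₀' hβ]
  rw [← heq, ← probReal_univ (μ := μ), ← mul_one (μ.real univ), ← smul_eq_mul (μ.real _),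
    ← integral_const, ← integral_sub (integrable_const 1) hint]
  refine integral_congr_ae ?_
  filter_upwards [hY₀] with ω hω
  exact hG _ (mul_nonneg hβ.le hω)

theorem asep_eq [IsProbabilityMeasure μ] (hY : Measurable Y) (hY₀ : ∀ᵐ ω ∂μ, 0 ≤ Y ω)
    {β₁ β₂ : ℝ} (hβ₁ : 0 < β₁) (hβ₂ : 0 < β₂) (w₁ w₂ : ℝ) :
    asep μ w₁ w₂ β₁ β₂ Y =
      w₁ * (1 - 1 / √Real.pi * ∫ z in Ioi (0 : ℝ), Real.exp (-z) / √z *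
        μ.real {ω | z / β₁ ≤ Y ω}) +
      w₂ * (1 - 2 / √Real.pi * ∫ z in Ioi (0 : ℝ), Real.exp (-z) * erfc √z / √z *
        μ.real {ω | z / β₂ ≤ Y ω}) := by
  have hk₁ := integrableOn_exp_neg_div_sqrt.const_mul (1 / √Real.pi)
  have hk₂ := integrableOn_exp_neg_mul_erfc_div_sqrt.const_mul (2 / √Real.pi)
  have herfc₁ (x : ℝ) (hx : 0 ≤ x) :=
    eq_one_sub_integral_of_hasDerivAt_neg continuous_erfc_sqrt (by simp [erfc_zero])
      (fun z => hasDerivAt_erfc_sqrt) hk₁ hx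
  have herfc₂ (x : ℝ) (hx : 0 ≤ x) :=
    eq_one_sub_integral_of_hasDerivAt_neg (continuous_erfc_sqrt.pow 2) (by simp [erfc_zero])
      (fun z hz => ((hasDerivAt_erfc_sqrt hz).pow 2).congr_deriv (by push_cast; ring)) hk₂ hx
  rw [asep, integral_comp_mul_eq_one_sub hY hY₀ hk₁ herfc₁ hβ₁,
    integral_comp_mul_eq_one_sub (G := fun x => erfc √x ^ 2) hY hY₀ hk₂ herfc₂ hβ₂]
  simp_rw [mul_assoc _ _ (μ.real _), integral_const_mul]

end TailFormula

theorem IsDownlinkNetwork.asep_eq {Ω : Type*} [MeasurableSpace Ω] {μ : Measure Ω}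
    [IsProbabilityMeasure μ] {lam P η : ℝ} {X : ℕ → Ω → Plane} {h : ℕ → Ω → ℂ}
    (hnet : IsDownlinkNetwork μ lam X h) (hlam : 0 < lam) (hP : P ≠ 0) (hη : 2 < η)
    {β₁ β₂ : ℝ} (hβ₁ : 0 < β₁) (hβ₂ : 0 < β₂) (w₁ w₂ : ℝ) :
    asep μ w₁ w₂ β₁ β₂ (sinr P η 0 X h) =
      w₁ * (1 - 1 / √Real.pi * ∫ z in Ioi (0 : ℝ), Real.exp (-z) / √z *
        (1 / (1 + interferenceFactor η (z / β₁)))) +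
      w₂ * (1 - 2 / √Real.pi * ∫ z in Ioi (0 : ℝ), Real.exp (-z) * erfc √z / √z *
        (1 / (1 + interferenceFactor η (z / β₂)))) := by
  have hsinr : ∀ᵐ ω ∂μ, 0 ≤ sinr P η 0 X h ω := by
    filter_upwards [hnet.ae_serviceDist_pos hlam] with ω hr
    rw [sinr_zero_eq hP hr]
    exact div_nonneg (sq_nonneg _) (tsum_nonneg fun k => relPower_nonneg η X h k ω)
  have hcoverage {β : ℝ} (hβ : 0 < β) (k : ℝ → ℝ) :
      ∫ z in Ioi (0 : ℝ), k z * μ.real {ω | z / β ≤ sinr P η 0 X h ω} =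
        ∫ z in Ioi (0 : ℝ), k z * (1 / (1 + interferenceFactor η (z / β))) :=
    setIntegral_congr_fun measurableSet_Ioi fun z hz => by
      rw [hnet.measureReal_le_sinr hlam hP hη (div_nonneg (le_of_lt hz) hβ.le)]
  rw [Cellular.asep_eq hnet.measurable_sinr hsinr hβ₁ hβ₂, hcoverage hβ₁, hcoverage hβ₂]

end Cellular

theorem mainTheorem6_general {Ω : Type*} [MeasurableSpace Ω] (μ : Measure Ω)
    [IsProbabilityMeasure μ] (lam P η : ℝ) (hlam : 0 < lam) (hP : P ≠ 0) (hη : 2 < η)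
    (X : ℕ → Ω → Cellular.Plane) (h : ℕ → Ω → ℂ)
    (hnet : Cellular.IsDownlinkNetwork μ lam X h) :
    (∀ᵐ ω ∂μ, Summable fun k : ℕ => Cellular.rxPower P η X h (k + 1) ω) ∧
    μ.map (Cellular.serviceDist X) = (volume.restrict (Ioi (0 : ℝ))).withDensity
      (fun r => ENNReal.ofReal (2 * Real.pi * lam * r * Real.exp (-(Real.pi * lam * r ^ 2)))) ∧
    (∀ a : ℝ, 0 ≤ a →
      (∫ r in Ioi (0 : ℝ), 2 * Real.pi * lam * r * Real.exp (-(Real.pi * lam * r ^ 2)) *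
          Cellular.condLT μ P η X h (a * r ^ η / P) r) =
        (∫ r in Ioi (0 : ℝ), 2 * Real.pi * lam * r *
          Real.exp (-(Real.pi * lam * r ^ 2 * (Cellular.interferenceFactor η a + 1)))) ∧
      (∫ r in Ioi (0 : ℝ), 2 * Real.pi * lam * r * Real.exp (-(Real.pi * lam * r ^ 2)) *
          Cellular.condLT μ P η X h (a * r ^ η / P) r) =
        1 / (1 + Cellular.interferenceFactor η a) ∧
      (∫ ω, Real.exp (-(a * Cellular.serviceDist X ω ^ η / P *
          Cellular.interference P η X h ω)) ∂μ) =
        1 / (1 + Cellular.interferenceFactor η a)) ∧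
    (∀ T : ℝ, 0 ≤ T →
      Cellular.outage μ (Cellular.sinr P η 0 X h) T =
        1 - 1 / (1 + Cellular.interferenceFactor η T)) ∧
    (∀ w₁ w₂ β₁ β₂ : ℝ, 0 < β₁ → 0 < β₂ →
      Cellular.asep μ w₁ w₂ β₁ β₂ (Cellular.sinr P η 0 X h) =
        w₁ * (1 - 1 / √Real.pi * ∫ z in Ioi (0 : ℝ), Real.exp (-z) / √z *
          (1 / (1 + Cellular.interferenceFactor η (z / β₁)))) +
        w₂ * (1 - 2 / √Real.pi * ∫ z in Ioi (0 : ℝ), Real.exp (-z) * Cellular.erfc √z / √z *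
          (1 / (1 + Cellular.interferenceFactor η (z / β₂))))) := by
  refine ⟨hnet.ae_summable_rxPower hlam hη, hnet.ppp.map_serviceDist hlam hnet.ordered,
    fun a ha => ?_, fun T => hnet.outage_eq hlam hP hη,
    fun w₁ w₂ β₁ β₂ hβ₁ hβ₂ => hnet.asep_eq hlam hP hη hβ₁ hβ₂ w₁ w₂⟩
  have hcondLT := hnet.integral_condLT hlam hP hη ha
  have hexponent := Cellular.integral_rayleigh_mul_add_one hlam
    (Cellular.interferenceFactor_nonneg hη ha)
  exact ⟨hcondLT.trans hexponent.symm, hcondLT,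
    hnet.integral_exp_neg_mul_interference hlam hP hη ha⟩

theorem mainTheorem6 {Ω : Type*} [MeasurableSpace Ω] (μ : Measure Ω) [IsProbabilityMeasure μ]
    (lam P : ℝ) (hlam : 0 < lam) (hP : 0 < P)
    (X : ℕ → Ω → Cellular.Plane) (h : ℕ → Ω → ℂ)
    (hnet : Cellular.IsDownlinkNetwork μ lam X h) :
    -- the interference series converges almost surely
    (∀ᵐ ω ∂μ, Summable fun k : ℕ => Cellular.rxPower P 4 X h (k + 1) ω) ∧
    -- law of the service distance
    μ.map (Cellular.serviceDist X) = (volume.restrict (Ioi (0 : ℝ))).withDensity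
      (fun r => ENNReal.ofReal (2 * Real.pi * lam * r * Real.exp (-(Real.pi * lam * r ^ 2)))) ∧
    -- the Laplace transform at `a r₀⁴ / P`, averaged over the service distance
    (∀ a : ℝ, 0 ≤ a →
      (∫ r in Ioi (0 : ℝ), 2 * Real.pi * lam * r * Real.exp (-(Real.pi * lam * r ^ 2)) *
          Cellular.condLT μ P 4 X h (a * r ^ 4 / P) r) =
        (∫ r in Ioi (0 : ℝ), 2 * Real.pi * lam * r *
          Real.exp (-(Real.pi * lam * r ^ 2 * (√a * Real.arctan √a + 1)))) ∧
      (∫ r in Ioi (0 : ℝ), 2 * Real.pi * lam * r * Real.exp (-(Real.pi * lam * r ^ 2)) *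
          Cellular.condLT μ P 4 X h (a * r ^ 4 / P) r) =
        1 / (1 + √a * Real.arctan √a) ∧
      (∫ ω, Real.exp (-(a * Cellular.serviceDist X ω ^ 4 / P *
          Cellular.interference P 4 X h ω)) ∂μ) =
        1 / (1 + √a * Real.arctan √a)) ∧
    -- outage probability without noise
    (∀ T : ℝ, 0 ≤ T →
      Cellular.outage μ (Cellular.sinr P 4 0 X h) T = 1 - 1 / (1 + √T * Real.arctan √T)) ∧
    -- average symbol error probability without noise
    (∀ w₁ w₂ β₁ β₂ : ℝ, 0 < β₁ → 0 < β₂ →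
      Cellular.asep μ w₁ w₂ β₁ β₂ (Cellular.sinr P 4 0 X h) =
        w₁ * (1 - 1 / √Real.pi * ∫ z in Ioi (0 : ℝ), Real.exp (-z) / √z *
          (1 / (1 + √(z / β₁) * Real.arctan √(z / β₁)))) +
        w₂ * (1 - 2 / √Real.pi * ∫ z in Ioi (0 : ℝ), Real.exp (-z) * Cellular.erfc √z / √z *
          (1 / (1 + √(z / β₂) * Real.arctan √(z / β₂))))) := by
  simpa +contextual only [Real.rpow_ofNat, Cellular.interferenceFactor_four,
    Cellular.setIntegral_interferenceFactor_four] using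
    mainTheorem6_general μ lam P 4 hlam hP.ne' (by norm_num) X h hnet
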